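/- Let $M$ be a closed smooth manifold of dimension $2n+1$ with a contact form $\alpha$, i.e. a smooth one-form with $\alpha\wedge(\mathrm d\alpha)^n\neq 0$ everywhere, and let $g$ be a Riemannian metric on $M$. Let $X$ be the vector field $g$-dual to $\alpha$, $g(X,\cdot)=\alpha$, and suppose that the magnetic system $(M,g,\mathrm d\alpha)$ is Killing, i.e. that the flow of $X$ acts by isometries of $(M,g)$. Suppose moreover that $\mathrm d\alpha(X,\cdot)=0$. A magnetic geodesic of $(M,g,\mathrm d\alpha)$ is a smooth curve $\gamma:\mathbb R\to M$ with $\nabla_{\dot\gamma}\dot\gamma=Y_\gamma\dot\gamma$, where $\nabla$ is the Levi-Civita connection of $g$ and the Lorentz force $Y:TM\to TM$ is defined by $g(Yu,v)=\mathrm d\alpha(u,v)$. Then, for every magnetic geodesic $\gamma$, the function $t\mapsto g_{\gamma(t)}(X_{\gamma(t)},\dot\gamma(t))$ is constant. Moreover, the magnetic geodesic flow interpolates between the sub-Riemannian geodesic flow on $\xi:=\ker\alpha$ and the flow of $X$ in the following sense: 1. If $\dot\gamma(0)\in\xi_{\gamma(0)}$, then $\gamma$ is a sub-Riemannian geodesic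 tangent to $\xi$, for the metric $g|_\xi$: $\dot\gamma(t)\in\xi_{\gamma(t)}$ for all $t$, and every $t_0\in\mathbb R$ has a neighbourhood $J$ such that for all $a<b$ in $J$ the arc $\gamma|_{[a,b]}$ minimizes the energy $\int_a^b\tfrac12 g(\dot\delta,\dot\delta)\,\mathrm dt$ among all $C^1$ curves $\delta:[a,b]\to M$ tangent to $\xi$ with $\delta(a)=\gamma(a)$ and $\delta(b)=\gamma(b)$. 2. If $\dot\gamma(0)=r\,X_{\gamma(0)}$ for some $r\in\mathbb R$, then $\gamma$ is a flow line of the vector field $rX$, i.e. $\dot\gamma(t)=r\,X_{\gamma(t)}$ for all $t\in\mathbb R$. -/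

import Mathlib

open Bundle Set
open scoped Manifold ContDiff

noncomputable section

section ContactMagnetic

variable {E : Type*} [NormedAddCommGroup E] [NormedSpace ℝ E]
  {M : Type*} [TopologicalSpace M] [ChartedSpace E M]

/-- A smooth one-form on `M`, that is, a smooth section of the cotangent bundle. -/
abbrev SmoothOneForm (E : Type*) [NormedAddCommGroup E] [NormedSpace ℝ E]
    (M : Type*) [TopologicalSpace M] [ChartedSpace E M] [IsManifold 𝓘(ℝ, E) ∞ M] :=
  ContMDiffSection 𝓘(ℝ, E) (E →L[ℝ] ℝ) ∞ (fun x : M => TangentSpace 𝓘(ℝ, E) x →L[ℝ] ℝ)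

/-- A smooth Riemannian metric on `M`. -/
abbrev SmoothMetric (E : Type*) [NormedAddCommGroup E] [NormedSpace ℝ E]
    (M : Type*) [TopologicalSpace M] [ChartedSpace E M] [IsManifold 𝓘(ℝ, E) ∞ M] :=
  ContMDiffRiemannianMetric 𝓘(ℝ, E) ∞ E (fun x : M => TangentSpace 𝓘(ℝ, E) x)

/-- The derivative at `y` of the inverse of the preferred chart at `x`. For `y` the image of `x`
it is the identity of `E`, which is how Mathlib identifies `T_x M` with `E`. -/
def chartInvDeriv (x : M) (y : E) :
    E →L[ℝ] TangentSpace 𝓘(ℝ, E) ((extChartAt 𝓘(ℝ, E) x).symm y) :=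
  mfderiv 𝓘(ℝ, E) 𝓘(ℝ, E) (extChartAt 𝓘(ℝ, E) x).symm y

/-- The velocity at time `t` of a curve in `M`. -/
def velocity (γ : ℝ → M) (t : ℝ) : TangentSpace 𝓘(ℝ, E) (γ t) :=
  mfderiv 𝓘(ℝ, ℝ) 𝓘(ℝ, E) γ t (1 : ℝ)

/-- The velocity at time `t` of a curve that is only considered on the time set `s`. -/
def velocityWithin (γ : ℝ → M) (s : Set ℝ) (t : ℝ) : TangentSpace 𝓘(ℝ, E) (γ t) :=
  mfderivWithin 𝓘(ℝ, ℝ) 𝓘(ℝ, E) γ s t (1 : ℝ)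

variable [IsManifold 𝓘(ℝ, E) ∞ M]

/-- The one-form `α`, read in the preferred chart at `x`. -/
def oneFormInChart (α : SmoothOneForm E M) (x : M) (y : E) : E →L[ℝ] ℝ :=
  (α ((extChartAt 𝓘(ℝ, E) x).symm y)).comp (chartInvDeriv x y)

/-- The exterior derivative of a one-form, as a bilinear form on `T_x M`, computed in the preferred
chart at `x`: `dα(u, v) = (D_u α)(v) - (D_v α)(u)`. -/
def dOneForm (α : SmoothOneForm E M) (x : M) :
    TangentSpace 𝓘(ℝ, E) x →L[ℝ] TangentSpace 𝓘(ℝ, E) x →L[ℝ] ℝ :=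
  letI D : E →L[ℝ] E →L[ℝ] ℝ := fderiv ℝ (oneFormInChart α x) (extChartAt 𝓘(ℝ, E) x x)
  D - D.flip

/-- The value of the `(2n+1)`-form `α ∧ (dα)^n` at `x` on the vectors `v 0, …, v (2n)`. -/
def wedgeContact (n : ℕ) (α : SmoothOneForm E M) (x : M)
    (v : Fin (2 * n + 1) → TangentSpace 𝓘(ℝ, E) x) : ℝ :=
  (1 / 2 ^ n : ℝ) * ∑ σ : Equiv.Perm (Fin (2 * n + 1)), ((Equiv.Perm.sign σ : ℤ) : ℝ) *
    (α x (v (σ 0)) * ∏ i : Fin n,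
      dOneForm α x (v (σ ⟨2 * i + 1, by omega⟩)) (v (σ ⟨2 * i + 2, by omega⟩)))

/-- `α` is a contact form on the `(2n+1)`-dimensional manifold `M`: the form `α ∧ (dα)^n`
vanishes nowhere. -/
def IsContactForm (n : ℕ) (α : SmoothOneForm E M) : Prop :=
  ∀ x : M, ∃ v : Fin (2 * n + 1) → TangentSpace 𝓘(ℝ, E) x, wedgeContact n α x v ≠ 0

/-- The vector field `X` is Killing for `g`: its flow `φ` acts on `M` by isometries. -/
def IsKillingField (g : SmoothMetric E M) (X : (x : M) → TangentSpace 𝓘(ℝ, E) x) : Prop :=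
  ∃ φ : ℝ → M → M,
    ContMDiff (𝓘(ℝ, ℝ).prod 𝓘(ℝ, E)) 𝓘(ℝ, E) ∞ (fun p : ℝ × M => φ p.1 p.2) ∧
    (∀ x, φ 0 x = x) ∧
    (∀ x, IsMIntegralCurve (fun t => φ t x) X) ∧
    ∀ (t : ℝ) (x : M) (v w : TangentSpace 𝓘(ℝ, E) x),
      g.inner (φ t x) (mfderiv 𝓘(ℝ, E) 𝓘(ℝ, E) (φ t) x v) (mfderiv 𝓘(ℝ, E) 𝓘(ℝ, E) (φ t) x w) =
        g.inner x v w

/-- The metric `g`, read in the preferred chart at `x`. -/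
def metricInChart (g : SmoothMetric E M) (x : M) (y : E) : E →L[ℝ] E →L[ℝ] ℝ :=
  letI G : E →L[ℝ] E →L[ℝ] ℝ := g.inner ((extChartAt 𝓘(ℝ, E) x).symm y)
  letI A : E →L[ℝ] E := chartInvDeriv x y
  G.bilinearComp A A

/-- The Christoffel symbols of the first kind of `g` at `x`, in the preferred chart at `x`: the
functional `w ↦ (1/2) (D_u g(v, w) + D_v g(u, w) - D_w g(u, v))`. -/
def christoffelFirst (g : SmoothMetric E M) (x : M) (u v : E) : E →L[ℝ] ℝ :=
  letI p : E := extChartAt 𝓘(ℝ, E) x x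
  (1 / 2 : ℝ) • (fderiv ℝ (fun y => metricInChart g x y v) p u +
    fderiv ℝ (fun y => metricInChart g x y u) p v - fderiv ℝ (fun y => metricInChart g x y u v) p)

/-- The energy `∫ (1/2) g(δ', δ') dt` of a curve on `[a, b]`. -/
def curveEnergy (g : SmoothMetric E M) (δ : ℝ → M) (a b : ℝ) : ℝ :=
  ∫ t in a..b, (1 / 2 : ℝ) *
    g.inner (δ t) (velocityWithin δ (Icc a b) t) (velocityWithin δ (Icc a b) t)

/-- `γ` is a sub-Riemannian geodesic of the distribution `ker α` with the metric induced by `g`: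
a smooth curve tangent to `ker α` whose sufficiently short arcs minimize the energy among all
`C^1` curves tangent to `ker α` that are parametrized on the same time interval and have the same
endpoints (equivalently, `γ` has constant speed and locally minimizes the length of curves
tangent to `ker α`). -/
structure IsSubRiemannianGeodesic (g : SmoothMetric E M) (α : SmoothOneForm E M) (γ : ℝ → M) :
    Prop where
  smooth : ContMDiff 𝓘(ℝ, ℝ) 𝓘(ℝ, E) ∞ γ
  horizontal : ∀ t, α (γ t) (velocity γ t) = 0
  locally_minimizing : ∀ t₀ : ℝ, ∃ ε > 0, ∀ a b : ℝ, t₀ - ε < a → a < b → b < t₀ + ε →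
    ∀ δ : ℝ → M, ContMDiffOn 𝓘(ℝ, ℝ) 𝓘(ℝ, E) 1 δ (Icc a b) →
      (∀ t ∈ Icc a b, α (δ t) (velocityWithin δ (Icc a b) t) = 0) →
      δ a = γ a → δ b = γ b → curveEnergy g γ a b ≤ curveEnergy g δ a b

variable [FiniteDimensional ℝ E]

theorem exists_sharp (g : SmoothMetric E M) (x : M) (l : TangentSpace 𝓘(ℝ, E) x →L[ℝ] ℝ) :
    ∃ u : TangentSpace 𝓘(ℝ, E) x, ∀ w, g.inner x u w = l w := by
  have : FiniteDimensional ℝ (TangentSpace 𝓘(ℝ, E) x) := inferInstanceAs (FiniteDimensional ℝ E)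
  let f : TangentSpace 𝓘(ℝ, E) x →ₗ[ℝ] Module.Dual ℝ (TangentSpace 𝓘(ℝ, E) x) :=
    { toFun := fun u => (g.inner x u).toLinearMap
      map_add' := fun u v => by ext w; simp
      map_smul' := fun c u => by ext w; simp }
  have hf : Function.Injective f := by
    rw [injective_iff_map_eq_zero]
    intro u hu
    by_contra hne
    have h1 := g.pos x u hne
    have h2 : g.inner x u u = 0 := congrArg (fun k => k u) hu
    exact absurd h2 h1.ne'
  have hs : Function.Surjective f :=
    (LinearMap.injective_iff_surjective_of_finrank_eq_finrank
      (Subspace.dual_finrank_eq (K := ℝ) (V := TangentSpace 𝓘(ℝ, E) x)).symm).1 hf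
  obtain ⟨u, hu⟩ := hs l.toLinearMap
  exact ⟨u, fun w => congrArg (fun k => k w) hu⟩

/-- The vector that is `g`-dual to the covector `l`, characterized by `g(sharp l, w) = l(w)`. -/
def sharp (g : SmoothMetric E M) (x : M) (l : TangentSpace 𝓘(ℝ, E) x →L[ℝ] ℝ) :
    TangentSpace 𝓘(ℝ, E) x :=
  (exists_sharp g x l).choose

theorem inner_sharp (g : SmoothMetric E M) (x : M) (l : TangentSpace 𝓘(ℝ, E) x →L[ℝ] ℝ)
    (w : TangentSpace 𝓘(ℝ, E) x) : g.inner x (sharp g x l) w = l w :=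
  (exists_sharp g x l).choose_spec w

/-- The vector field `g`-dual to the one-form `α`. -/
def dualField (g : SmoothMetric E M) (α : SmoothOneForm E M) (x : M) : TangentSpace 𝓘(ℝ, E) x :=
  sharp g x (α x)

/-- The Lorentz force of the magnetic system `(M, g, dα)`: `g(Y u, v) = dα(u, v)`. -/
def lorentzForce (g : SmoothMetric E M) (α : SmoothOneForm E M) (x : M)
    (u : TangentSpace 𝓘(ℝ, E) x) : TangentSpace 𝓘(ℝ, E) x :=
  sharp g x (dOneForm α x u)

/-- The covariant acceleration `∇_{γ'} γ'` at time `t` for the Levi-Civita connection of `g`: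
with `c` the curve read in the preferred chart at `γ t`, it is `c'' + Γ(c', c')`. -/
def covariantAcceleration (g : SmoothMetric E M) (γ : ℝ → M) (t : ℝ) :
    TangentSpace 𝓘(ℝ, E) (γ t) :=
  letI c : ℝ → E := fun s => extChartAt 𝓘(ℝ, E) (γ t) (γ s)
  letI a : E := deriv (deriv c) t
  letI Γ : E →L[ℝ] ℝ := christoffelFirst g (γ t) (deriv c t) (deriv c t)
  letI a' : TangentSpace 𝓘(ℝ, E) (γ t) := a
  a' + sharp g (γ t) Γ

/-- `γ` is a magnetic geodesic of `(M, g, dα)`: `∇_{γ'} γ' = Y γ'`. -/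
structure IsMagneticGeodesic (g : SmoothMetric E M) (α : SmoothOneForm E M) (γ : ℝ → M) :
    Prop where
  smooth : ContMDiff 𝓘(ℝ, ℝ) 𝓘(ℝ, E) ∞ γ
  equation : ∀ t, covariantAcceleration g γ t = lorentzForce g α (γ t) (velocity γ t)

end ContactMagnetic

end

/-! ### Calculus in a normed space: Killing and Euler-Lagrange equations, Taylor and integral
bounds. -/

section Calculus

open Filter Topology MeasureTheory

set_option synthInstance.maxHeartbeats 200000

variable {E : Type*} [NormedAddCommGroup E] [NormedSpace ℝ E]
  {F : Type*} [NormedAddCommGroup F] [NormedSpace ℝ F]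

/-! In coordinates, with `G` the metric and `A` the one-form, the magnetic geodesic equation is the
Euler-Lagrange equation of the Lagrangian `G(v, v) / 2 - A(v)`.

Conservation. The derivative of α(γ') = g(X, γ') is g(∇_{γ'} X, γ') + g(X, Yγ'). The first term
vanishes because X is Killing, the second is dα(γ', X) = 0. Two more quantities are constant along
γ: |γ'|², since Y is skew, and |X|² = α(X), since for a Killing field d|X|² is a multiple of dα(X,
·). These are `oneForm_velocity_const`, `energy_const` and `oneForm_dualField_const`.

Flow lines. |γ' - rX|² = |γ'|² - 2r α(γ') + r²|X|² is built from the three constants, so it vanishes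
for all time if it does at time 0.

Horizontal case. By conservation γ stays tangent to ker α, and on horizontal curves action and
energy agree. It therefore suffices that short arcs of γ minimize the action among all curves with
the same endpoints. The difference of two actions is the first variation, which integrates to zero,
plus a remainder bounded below by m|η'|² - C(|η|² + |η||η'|) for the displacement η, with suitable
constants m and C. On a short interval a Poincaré inequality makes its integral nonnegative
(`action_le_of_eulerLagrange`). A competitor that leaves a fixed chart ball in a short time already
spends more energy than γ (`exists_short_arcs_minimizing`). -/

theorem HasFDerivAt.clm_apply₂ {G : F → E →L[ℝ] E →L[ℝ] ℝ} {u w : F → E} {p : F}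
    {G' : F →L[ℝ] E →L[ℝ] E →L[ℝ] ℝ} {u' w' : F →L[ℝ] E}
    (hG : HasFDerivAt G G' p) (hu : HasFDerivAt u u' p) (hw : HasFDerivAt w w' p) (z : F) :
    fderiv ℝ (fun y => G y (u y) (w y)) p z =
      G' z (u p) (w p) + G p (u' z) (w p) + G p (u p) (w' z) := by
  rw [((hG.clm_apply hu).clm_apply hw).fderiv]
  simp
  ring

theorem HasDerivAt.clm_apply₂ {G : ℝ → E →L[ℝ] E →L[ℝ] ℝ} {u w : ℝ → E} {t : ℝ}
    {G' : E →L[ℝ] E →L[ℝ] ℝ} {u' w' : E}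
    (hG : HasDerivAt G G' t) (hu : HasDerivAt u u' t) (hw : HasDerivAt w w' t) :
    HasDerivAt (fun s => G s (u s) (w s)) (G' (u t) (w t) + G t u' (w t) + G t (u t) w') t := by
  have := (hG.clm_apply hu).clm_apply hw
  simpa using this

/-- The Killing equation, from the invariance of a metric under a local flow. -/
theorem killing_equation {G : E → E →L[ℝ] E →L[ℝ] ℝ} {Φ : ℝ × E → E} {p : E}
    (hG : DifferentiableAt ℝ G p) (hΦ : ContDiffAt ℝ 2 Φ (0, p))
    (h0 : ∀ᶠ y in 𝓝 p, Φ (0, y) = y)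
    (hiso : ∀ᶠ t in 𝓝 (0 : ℝ), ∀ u w, G (Φ (t, p)) (fderiv ℝ (fun y => Φ (t, y)) p u)
      (fderiv ℝ (fun y => Φ (t, y)) p w) = G p u w) (u w : E) :
    fderiv ℝ G p (fderiv ℝ Φ (0, p) (1, 0)) u w +
      G p (fderiv ℝ (fun y => fderiv ℝ Φ (0, y) (1, 0)) p u) w +
      G p u (fderiv ℝ (fun y => fderiv ℝ Φ (0, y) (1, 0)) p w) = 0 := by
  have hd : ∀ᶠ t in 𝓝 (0 : ℝ), DifferentiableAt ℝ Φ (t, p) := by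
    have h1 : ∀ᶠ q in 𝓝 ((0 : ℝ), p), DifferentiableAt ℝ Φ q :=
      (hΦ.eventually (by simp)).mono fun q hq => hq.differentiableAt (by simp)
    have h2 : ContinuousAt (fun t : ℝ => (t, p)) 0 := by fun_prop
    exact h2.eventually h1
  have hD2 : HasFDerivAt (fderiv ℝ Φ) (fderiv ℝ (fderiv ℝ Φ) (0, p)) (0, p) :=
    ((hΦ.fderiv_right (m := 1) (by norm_num)).differentiableAt (by simp)).hasFDerivAt
  have hsymm := hΦ.isSymmSndFDerivAt (by simp)
  have hX (u : E) : fderiv ℝ (fun y => fderiv ℝ Φ (0, y) (1, 0)) p u =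
      fderiv ℝ (fderiv ℝ Φ) (0, p) (0, u) (1, 0) := by
    have h1 : HasFDerivAt (fun y : E => ((0 : ℝ), y)) (ContinuousLinearMap.inr ℝ ℝ E) p :=
      hasFDerivAt_prodMk_right _ _
    have h2 := (hD2.comp p h1).clm_apply (hasFDerivAt_const ((1 : ℝ), (0 : E)) p)
    have h3 := h2.fderiv
    simp only [Function.comp_def] at h3
    rw [h3]
    simp
  have hpart : ∀ᶠ t in 𝓝 (0 : ℝ), ∀ u, fderiv ℝ (fun y => Φ (t, y)) p u = fderiv ℝ Φ (t, p) (0, u) := by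
    filter_upwards [hd] with t ht u
    have h1 : HasFDerivAt (fun y : E => (t, y)) (ContinuousLinearMap.inr ℝ ℝ E) p :=
      hasFDerivAt_prodMk_right _ _
    have h3 := (ht.hasFDerivAt.comp p h1).fderiv
    simp only [Function.comp_def] at h3
    rw [h3]
    simp
  have hid (u : E) : fderiv ℝ Φ (0, p) (0, u) = u := by
    rw [← hpart.self_of_nhds u]
    have : (fun y => Φ (0, y)) =ᶠ[𝓝 p] id := h0
    rw [this.fderiv_eq]
    simp
  have hu (u : E) : HasDerivAt (fun t : ℝ => fderiv ℝ Φ (t, p) (0, u))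
      (fderiv ℝ (fun y => fderiv ℝ Φ (0, y) (1, 0)) p u) 0 := by
    have h1 : HasDerivAt (fun t : ℝ => (t, p)) ((1 : ℝ), (0 : E)) 0 :=
      (hasDerivAt_id (0 : ℝ)).prodMk (hasDerivAt_const _ _)
    have h2 : HasDerivAt (fun t : ℝ => fderiv ℝ Φ (t, p))
        (fderiv ℝ (fderiv ℝ Φ) (0, p) (1, 0)) 0 := hD2.comp_hasDerivAt_of_eq (0 : ℝ) h1 rfl
    have h3 := h2.clm_apply (hasDerivAt_const (0 : ℝ) ((0 : ℝ), u))
    -- Symmetry of the second derivative: the time derivative of the spatial differential of the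
    -- flow is the spatial differential of its generator.
    rw [hX, ← hsymm.eq]
    simpa only [map_zero, add_zero] using h3
  have hΦt : HasDerivAt (fun t : ℝ => Φ (t, p)) (fderiv ℝ Φ (0, p) (1, 0)) 0 := by
    have h1 : HasDerivAt (fun t : ℝ => (t, p)) ((1 : ℝ), (0 : E)) 0 :=
      (hasDerivAt_id (0 : ℝ)).prodMk (hasDerivAt_const _ _)
    exact hd.self_of_nhds.hasFDerivAt.comp_hasDerivAt_of_eq (0 : ℝ) h1 rfl
  have hG' : HasDerivAt (fun t : ℝ => G (Φ (t, p))) (fderiv ℝ G p (fderiv ℝ Φ (0, p) (1, 0))) 0 := by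
    exact HasFDerivAt.comp_hasDerivAt_of_eq (E := E →L[ℝ] E →L[ℝ] ℝ)
      (f := fun t : ℝ => Φ (t, p)) (0 : ℝ) hG.hasFDerivAt hΦt
      h0.self_of_nhds.symm
  have hfinal := hG'.clm_apply₂ (hu u) (hu w)
  have hconst : (fun t : ℝ => G (Φ (t, p)) (fderiv ℝ Φ (t, p) (0, u)) (fderiv ℝ Φ (t, p) (0, w)))
      =ᶠ[𝓝 0] fun _ => G p u w := by
    filter_upwards [hiso, hpart] with t h1 h2
    rw [← h2 u, ← h2 w, h1]
  have := hfinal.unique ((hasDerivAt_const (0 : ℝ) (G p u w)).congr_of_eventuallyEq hconst)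
  simpa [hid, h0.self_of_nhds] using this

/-- The Euler-Lagrange equation at the position `y`, for the velocity `v` and the acceleration `a`,
of the Lagrangian `G(v, v) / 2 - A(v)`. -/
def EulerLagrangeAt (G : E → E →L[ℝ] E →L[ℝ] ℝ) (A : E → E →L[ℝ] ℝ) (y v a : E) : Prop :=
  ∀ w, G y a w + fderiv ℝ G y v v w - (1 / 2) * fderiv ℝ G y w v v =
    fderiv ℝ A y v w - fderiv ℝ A y w v

/-- The Euler-Lagrange equation does not depend on the coordinates. -/
theorem EulerLagrangeAt.pullback {G G₁ : E → E →L[ℝ] E →L[ℝ] ℝ} {A A₁ : E → E →L[ℝ] ℝ}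
    {ψ : E → E} {y v a : E} (hψ : ContDiffAt ℝ 2 ψ y) (hG₁ : DifferentiableAt ℝ G₁ (ψ y))
    (hA₁ : DifferentiableAt ℝ A₁ (ψ y)) (hG : DifferentiableAt ℝ G y) (hA : DifferentiableAt ℝ A y)
    (hGG : ∀ᶠ z in 𝓝 y, ∀ u w, G z u w = G₁ (ψ z) (fderiv ℝ ψ z u) (fderiv ℝ ψ z w))
    (hAA : ∀ᶠ z in 𝓝 y, ∀ u, A z u = A₁ (ψ z) (fderiv ℝ ψ z u))
    (hsymm : ∀ u w, G₁ (ψ y) u w = G₁ (ψ y) w u)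
    (h : EulerLagrangeAt G₁ A₁ (ψ y) (fderiv ℝ ψ y v)
      (fderiv ℝ (fderiv ℝ ψ) y v v + fderiv ℝ ψ y a)) :
    EulerLagrangeAt G A y v a := by
  have hs := hψ.isSymmSndFDerivAt (by simp)
  have hψ1 : HasFDerivAt ψ (fderiv ℝ ψ y) y := (hψ.differentiableAt (by simp)).hasFDerivAt
  have hψ2 : HasFDerivAt (fderiv ℝ ψ) (fderiv ℝ (fderiv ℝ ψ) y) y :=
    ((hψ.fderiv_right (m := 1) (by norm_num)).differentiableAt (by simp)).hasFDerivAt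
  have hDu (u : E) : HasFDerivAt (fun z => fderiv ℝ ψ z u)
      ((fderiv ℝ (fderiv ℝ ψ) y).flip u) y := by
    have := hψ2.clm_apply (hasFDerivAt_const u y)
    convert this using 1
    ext; simp
  have hDG (z u w : E) : fderiv ℝ G y z u w =
      fderiv ℝ G₁ (ψ y) (fderiv ℝ ψ y z) (fderiv ℝ ψ y u) (fderiv ℝ ψ y w) +
      G₁ (ψ y) (fderiv ℝ (fderiv ℝ ψ) y z u) (fderiv ℝ ψ y w) +
      G₁ (ψ y) (fderiv ℝ ψ y u) (fderiv ℝ (fderiv ℝ ψ) y z w) := by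
    have h1 := hG.hasFDerivAt.clm_apply₂ (hasFDerivAt_const u y) (hasFDerivAt_const w y) z
    have h2 := (HasFDerivAt.comp (G := E →L[ℝ] E →L[ℝ] ℝ) y hG₁.hasFDerivAt hψ1).clm_apply₂ (hDu u) (hDu w) z
    have h3 : (fun z => G z u w) =ᶠ[𝓝 y]
        (fun z => (G₁ ∘ ψ) z (fderiv ℝ ψ z u) (fderiv ℝ ψ z w)) := by
      filter_upwards [hGG] with z hz using hz u w
    rw [h3.fderiv_eq, h2] at h1
    simpa using h1.symm
  have hDA (z u : E) : fderiv ℝ A y z u =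
      fderiv ℝ A₁ (ψ y) (fderiv ℝ ψ y z) (fderiv ℝ ψ y u) +
      A₁ (ψ y) (fderiv ℝ (fderiv ℝ ψ) y z u) := by
    have h1 := (hA.hasFDerivAt.clm_apply (hasFDerivAt_const u y)).fderiv
    have h2 := ((hA₁.hasFDerivAt.comp y hψ1).clm_apply (hDu u)).fderiv
    have h3 : (fun z => A z u) =ᶠ[𝓝 y] (fun z => (A₁ ∘ ψ) z (fderiv ℝ ψ z u)) := by
      filter_upwards [hAA] with z hz using hz u
    rw [h3.fderiv_eq, h2] at h1
    have := congrArg (fun L : E →L[ℝ] ℝ => L z) h1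
    simp at this
    linarith
  intro w
  have hw := h (fderiv ℝ ψ y w)
  -- Of the terms with the second derivative of `ψ`, the one in direction `(v, v)` belongs to the
  -- transformed acceleration; the mixed ones cancel, by symmetry of the Hessian and of `G₁`.
  rw [hGG.self_of_nhds, hDG, hDG, hDA, hDA, hs.eq w v]
  have := hsymm (fderiv ℝ ψ y v) (fderiv ℝ (fderiv ℝ ψ) y v w)
  simp only [map_add, add_apply] at hw
  linarith

theorem norm_sub_le_integral_norm_deriv [CompleteSpace E] {f f' : ℝ → E} {a b : ℝ}
    (hf' : ContinuousOn f' (Icc a b)) (hf : ∀ t ∈ Icc a b, HasDerivWithinAt f (f' t) (Icc a b) t)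
    {t : ℝ} (ht : t ∈ Icc a b) : ‖f t - f a‖ ≤ ∫ s in a..b, ‖f' s‖ := by
  have hsub : Icc a t ⊆ Icc a b := Icc_subset_Icc_right ht.2
  have h1 : ∫ s in a..t, f' s = f t - f a := by
    apply intervalIntegral.integral_eq_sub_of_hasDerivAt_of_le ht.1
    · exact fun s hs => ((hf s (hsub hs)).continuousWithinAt).mono hsub
    · intro s hs
      exact (hf s (hsub (Ioo_subset_Icc_self hs))).hasDerivAt
        (Icc_mem_nhds hs.1 (hs.2.trans_le ht.2))
    · exact ContinuousOn.intervalIntegrable (by rw [uIcc_of_le ht.1]; exact hf'.mono hsub)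
  rw [← h1]
  refine (intervalIntegral.norm_integral_le_integral_norm ht.1).trans ?_
  apply intervalIntegral.integral_mono_interval le_rfl ht.1 ht.2
  · exact Eventually.of_forall fun _ => norm_nonneg _
  · exact ContinuousOn.intervalIntegrable (by rw [uIcc_of_le (ht.1.trans ht.2)]; exact hf'.norm)

/-- Cauchy-Schwarz, by integrating `(h - μ) ^ 2 ≥ 0` with `μ` the mean of `h`. -/
theorem sq_integral_le {h : ℝ → ℝ} {a b : ℝ} (hab : a < b) (hh : ContinuousOn h (Icc a b)) :
    (∫ s in a..b, h s) ^ 2 ≤ (b - a) * ∫ s in a..b, h s ^ 2 := by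
  have hi : IntervalIntegrable h volume a b :=
    ContinuousOn.intervalIntegrable (by rwa [uIcc_of_le hab.le])
  have hi2 : IntervalIntegrable (fun s => h s ^ 2) volume a b :=
    ContinuousOn.intervalIntegrable (by rw [uIcc_of_le hab.le]; exact hh.pow 2)
  set I := ∫ s in a..b, h s
  have h1 : ∫ s in a..b, (2 * (I / (b - a)) * h s - (I / (b - a)) ^ 2) ≤ ∫ s in a..b, h s ^ 2 := by
    apply intervalIntegral.integral_mono_on hab.le ((hi.const_mul _).sub (by simp)) hi2
    intro s _
    nlinarith [sq_nonneg (h s - I / (b - a))]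
  rw [intervalIntegral.integral_sub (hi.const_mul _) (by simp),
    intervalIntegral.integral_const_mul, intervalIntegral.integral_const] at h1
  have hba : 0 < b - a := sub_pos.2 hab
  have h2 : 2 * (I / (b - a)) * I - (b - a) • (I / (b - a)) ^ 2 = I ^ 2 / (b - a) := by
    rw [smul_eq_mul]; field_simp; ring
  change 2 * (I / (b - a)) * I - _ ≤ _ at h1
  rw [h2, div_le_iff₀ hba] at h1
  linarith

/-- The Lipschitz constant of `fderiv ℝ f` near `y₀` controls the Taylor remainder and a bound on
its norm controls the increment. `C` is fixed before the radius, so the radius can still be shrunk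
afterwards. -/
theorem exists_taylor_bound {f : E → F} {y₀ : E} (hf : ContDiffAt ℝ 2 f y₀) :
    ∃ C, 0 ≤ C ∧ ∀ᶠ R in 𝓝[>] (0 : ℝ), ∀ y ∈ Metric.closedBall y₀ R, ∀ z ∈ Metric.closedBall y₀ R,
      ‖f z - f y - fderiv ℝ f y (z - y)‖ ≤ C * ‖z - y‖ ^ 2 ∧ ‖f z - f y‖ ≤ C * ‖z - y‖ := by
  have hf' : ContDiffAt ℝ 1 (fderiv ℝ f) y₀ := hf.fderiv_right (by norm_num)
  obtain ⟨K, t, ht, hK⟩ := hf'.exists_lipschitzOnWith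
  have hd : ∀ᶠ y in 𝓝 y₀, DifferentiableAt ℝ f y :=
    (hf.eventually (by simp)).mono fun q hq => hq.differentiableAt (by simp)
  have hb : ∀ᶠ y in 𝓝 y₀, ‖fderiv ℝ f y‖ < ‖fderiv ℝ f y₀‖ + 1 :=
    hf'.continuousAt.norm.eventually_lt continuousAt_const (by simp)
  refine ⟨max K (‖fderiv ℝ f y₀‖ + 1), by positivity, ?_⟩
  filter_upwards [nhdsWithin_le_nhds (eventually_closedBall_subset ht), nhdsWithin_le_nhds (eventually_closedBall_subset hd),
    nhdsWithin_le_nhds (eventually_closedBall_subset hb)] with R h1 h2 h3 y hy z hz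
  have hconv := convex_closedBall y₀ R
  constructor
  · have hseg : segment ℝ y z ⊆ Metric.closedBall y₀ R := hconv.segment_subset hy hz
    have := (convex_segment y z).norm_image_sub_le_of_norm_hasFDerivWithin_le' (𝕜 := ℝ)
      (f := f) (f' := fderiv ℝ f)
      (φ := fderiv ℝ f y) (C := K * ‖z - y‖)
      (fun x hx => (h2 (hseg hx)).hasFDerivAt.hasFDerivWithinAt) (fun x hx => ?_)
      (left_mem_segment ℝ y z) (right_mem_segment ℝ y z)
    · calc _ ≤ _ := this
        _ = K * ‖z - y‖ ^ 2 := by ring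
        _ ≤ _ := by gcongr; exact le_max_left _ _
    · refine (hK.norm_sub_le (h1 (hseg hx)) (h1 hy)).trans ?_
      gcongr
      exact norm_sub_le_of_mem_segment hx
  · refine (hconv.norm_image_sub_le_of_norm_fderiv_le (𝕜 := ℝ) (fun x hx => h2 hx)
      (fun x hx => (h3 hx).le) hy hz).trans ?_
    gcongr
    exact le_max_right _ _

/-- Compactness of the unit sphere gives a constant at `y₀`; half of it survives at nearby points
because `G` varies little there. -/
theorem exists_coercive_bound [FiniteDimensional ℝ E] {G : E → E →L[ℝ] E →L[ℝ] ℝ} {y₀ : E}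
    (hG : ContDiffAt ℝ 2 G y₀) (hpos : ∀ v, v ≠ 0 → 0 < G y₀ v v) :
    ∃ m, 0 < m ∧ ∀ᶠ R in 𝓝[>] (0 : ℝ), ∀ y ∈ Metric.closedBall y₀ R, ∀ v,
      m * ‖v‖ ^ 2 ≤ G y v v := by
  obtain ⟨m, hm, h⟩ := (isCompact_sphere (0 : E) 1).exists_forall_le' (f := fun v => G y₀ v v)
    (by fun_prop) (a := 0) (fun v hv => hpos v (ne_zero_of_mem_sphere one_ne_zero ⟨v, hv⟩))
  have hmv (v : E) : m * ‖v‖ ^ 2 ≤ G y₀ v v := by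
    rcases eq_or_ne v 0 with rfl | hv
    · simp
    · have hn := norm_pos_iff.2 hv
      have := h (‖v‖⁻¹ • v) (by simp [norm_smul, hn.ne'])
      simp only [map_smul, smul_apply, smul_eq_mul] at this
      calc m * ‖v‖ ^ 2 ≤ (‖v‖⁻¹ * (‖v‖⁻¹ * G y₀ v v)) * ‖v‖ ^ 2 := by gcongr
        _ = G y₀ v v := by field_simp
  obtain ⟨C, hC, hCR⟩ := exists_taylor_bound hG
  have hsmall : ∀ᶠ R in 𝓝[>] (0 : ℝ), C * R < m / 2 := by
    have : ContinuousAt (fun R : ℝ => C * R) 0 := by fun_prop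
    exact nhdsWithin_le_nhds (this.eventually_lt continuousAt_const (by simpa using hm))
  refine ⟨m / 2, by positivity, ?_⟩
  filter_upwards [hCR, hsmall, self_mem_nhdsWithin] with R h1 hR hR0 y hy v
  have hy' : ‖G y - G y₀‖ ≤ m / 2 := by
    refine ((h1 y₀ (Metric.mem_closedBall_self (le_of_lt hR0)) y hy).2).trans (le_trans ?_ hR.le)
    rw [← dist_eq_norm]
    exact mul_le_mul_of_nonneg_left hy hC
  have h2 := (G y - G y₀).le_opNorm₂ v v
  have h3 : ‖G y - G y₀‖ * ‖v‖ * ‖v‖ ≤ m / 2 * ‖v‖ * ‖v‖ := by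
    gcongr
  have h4 := (abs_le.1 (Real.norm_eq_abs _ ▸ h2)).1
  simp only [sub_apply] at h4
  nlinarith [hmv v]

/-- A Poincaré type inequality for curves that start at zero. -/
theorem integral_quadratic_nonneg [CompleteSpace E] {f f' : ℝ → E} {a b m C : ℝ} (hab : a < b)
    (hf' : ContinuousOn f' (Icc a b)) (hf : ∀ t ∈ Icc a b, HasDerivWithinAt f (f' t) (Icc a b) t)
    (ha : f a = 0) (hC : 0 ≤ C) (hmC : C * (b - a) * (1 + (b - a)) ≤ m) :
    0 ≤ ∫ t in a..b, (m * ‖f' t‖ ^ 2 - C * (‖f t‖ ^ 2 + ‖f t‖ * ‖f' t‖)) := by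
  have hfc : ContinuousOn f (Icc a b) := fun t ht => (hf t ht).continuousWithinAt
  set I := ∫ s in a..b, ‖f' s‖ with hI
  have hba : 0 < b - a := sub_pos.2 hab
  have hI0 : 0 ≤ I := intervalIntegral.integral_nonneg hab.le fun _ _ => norm_nonneg _
  have hle (t : ℝ) (ht : t ∈ Icc a b) : ‖f t‖ ≤ I := by
    simpa [ha] using norm_sub_le_integral_norm_deriv hf' hf ht
  have hsq := sq_integral_le hab hf'.norm
  have hi : IntervalIntegrable (fun t => ‖f' t‖) volume a b :=
    ContinuousOn.intervalIntegrable (by rw [uIcc_of_le hab.le]; exact hf'.norm)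
  have hi2 : IntervalIntegrable (fun t => ‖f' t‖ ^ 2) volume a b :=
    ContinuousOn.intervalIntegrable (by rw [uIcc_of_le hab.le]; exact hf'.norm.pow 2)
  have hi3 : IntervalIntegrable
      (fun t => m * ‖f' t‖ ^ 2 - C * (‖f t‖ ^ 2 + ‖f t‖ * ‖f' t‖)) volume a b :=
    ContinuousOn.intervalIntegrable (by rw [uIcc_of_le hab.le]; fun_prop)
  -- Since `f a = 0`, the norm of `f` never exceeds the length `I`, and `I ^ 2` is at most `b - a`
  -- times the integral of `‖f'‖ ^ 2`.
  have h1 : ∫ t in a..b, (m * ‖f' t‖ ^ 2 - (C * I ^ 2 + C * I * ‖f' t‖)) ≤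
      ∫ t in a..b, (m * ‖f' t‖ ^ 2 - C * (‖f t‖ ^ 2 + ‖f t‖ * ‖f' t‖)) := by
    apply intervalIntegral.integral_mono_on hab.le
      ((hi2.const_mul _).sub ((by simp : IntervalIntegrable _ _ _ _).add (hi.const_mul _))) hi3
    intro t ht
    have : ‖f t‖ ^ 2 + ‖f t‖ * ‖f' t‖ ≤ I ^ 2 + I * ‖f' t‖ := by
      have := hle t ht
      gcongr
    nlinarith
  refine le_trans ?_ h1
  rw [intervalIntegral.integral_sub (hi2.const_mul _)
    ((by simp : IntervalIntegrable _ _ _ _).add (hi.const_mul _)),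
    intervalIntegral.integral_add (by simp) (hi.const_mul _),
    intervalIntegral.integral_const_mul, intervalIntegral.integral_const_mul (C * I),
    intervalIntegral.integral_const, smul_eq_mul]
  change 0 ≤ _ - (_ + C * I * I)
  rw [← hI] at hsq
  set J := ∫ t in a..b, ‖f' t‖ ^ 2
  have hJ : 0 ≤ J := intervalIntegral.integral_nonneg hab.le fun _ _ => sq_nonneg _
  calc (0 : ℝ) ≤ (m - C * (b - a) * (1 + (b - a))) * J := mul_nonneg (sub_nonneg.2 hmC) hJ
    _ = m * J - C * (1 + (b - a)) * ((b - a) * J) := by ring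
    _ ≤ m * J - C * (1 + (b - a)) * I ^ 2 := by gcongr
    _ = _ := by ring

end Calculus

/-! ### Short solutions of the Euler-Lagrange equation minimize the action. -/

section ActionMinimization

open Filter Topology MeasureTheory

set_option synthInstance.maxHeartbeats 200000

variable {E : Type*} [NormedAddCommGroup E] [NormedSpace ℝ E]

/-- The Lagrangian `G(v, v) / 2 - A(v)` of a charged particle. -/
noncomputable def magneticLagrangian (G : E → E →L[ℝ] E →L[ℝ] ℝ) (A : E → E →L[ℝ] ℝ) (y v : E) : ℝ :=
  (1 / 2) * G y v v - A y v

/-- The linear part of the increment is subtracted. What remains is the quadratic velocity term,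
coercive by `hm`, and Taylor errors, each carrying a factor `‖z - y‖ ^ 2` or `‖z - y‖ * ‖v' - v‖`.
-/
theorem magneticLagrangian_sub_ge {G : E → E →L[ℝ] E →L[ℝ] ℝ} {A : E → E →L[ℝ] ℝ} {m C V : ℝ}
    {y z v v' : E} (hsymm : ∀ u w, G z u w = G z w u)
    (hG : ‖G z - G y - fderiv ℝ G y (z - y)‖ ≤ C * ‖z - y‖ ^ 2 ∧ ‖G z - G y‖ ≤ C * ‖z - y‖)
    (hA : ‖A z - A y - fderiv ℝ A y (z - y)‖ ≤ C * ‖z - y‖ ^ 2 ∧ ‖A z - A y‖ ≤ C * ‖z - y‖)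
    (hC : 0 ≤ C) (hm : ∀ w, m * ‖w‖ ^ 2 ≤ G z w w) (hv : ‖v‖ ≤ V) :
    m / 2 * ‖v' - v‖ ^ 2 - C * (1 + V) ^ 2 * (‖z - y‖ ^ 2 + ‖z - y‖ * ‖v' - v‖) ≤
      magneticLagrangian G A z v' - magneticLagrangian G A y v -
        ((1 / 2) * fderiv ℝ G y (z - y) v v - fderiv ℝ A y (z - y) v +
          (G y v (v' - v) - A y (v' - v))) := by
  obtain ⟨ζ, rfl⟩ : ∃ ζ, v' = v + ζ := ⟨v' - v, by abel⟩
  simp only [add_sub_cancel_left]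
  set η := z - y
  have hV : 0 ≤ V := (norm_nonneg v).trans hv
  have h1 : |(G z - G y - fderiv ℝ G y η) v v| ≤ C * ‖η‖ ^ 2 * V * V := by
    refine ((G z - G y - fderiv ℝ G y η).le_opNorm₂ v v).trans ?_
    gcongr; exact hG.1
  have h2 : |(G z - G y) v ζ| ≤ C * ‖η‖ * V * ‖ζ‖ := by
    refine ((G z - G y).le_opNorm₂ v ζ).trans ?_
    gcongr; exact hG.2
  have h3 : |(A z - A y - fderiv ℝ A y η) v| ≤ C * ‖η‖ ^ 2 * V := by
    refine ((A z - A y - fderiv ℝ A y η).le_opNorm v).trans ?_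
    gcongr; exact hA.1
  have h4 : |(A z - A y) ζ| ≤ C * ‖η‖ * ‖ζ‖ := by
    refine ((A z - A y).le_opNorm ζ).trans ?_
    gcongr; exact hA.2
  have h5 := hm ζ
  have hs := hsymm v ζ
  replace h1 := (abs_le.1 h1).1
  replace h2 := (abs_le.1 h2).1
  replace h3 := (abs_le.1 h3).2
  replace h4 := (abs_le.1 h4).2
  simp only [sub_apply] at h1 h2 h3 h4
  simp only [magneticLagrangian, map_add, add_apply]
  -- The slack between `(1 + V) ^ 2` and the actual coefficients: `V + V ^ 2 / 2` at `‖η‖ ^ 2` and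
  -- `1 + V` at `‖η‖ * ‖ζ‖`.
  have e1 : 0 ≤ C * ‖η‖ ^ 2 * (1 + V + V ^ 2 / 2) := by positivity
  have e2 : 0 ≤ C * (‖η‖ * ‖ζ‖) * (V + V ^ 2) := by positivity
  nlinarith

theorem continuousWithinAt_metric_apply {G : E → E →L[ℝ] E →L[ℝ] ℝ} {e e' : ℝ → E} {s : Set ℝ}
    {t : ℝ} (hG : ContDiffAt ℝ 2 G (e t)) (he : ContinuousWithinAt e s t)
    (he' : ContinuousWithinAt e' s t) :
    ContinuousWithinAt (fun r => G (e r) (e' r) (e' r)) s t :=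
  ((hG.continuousAt.comp_continuousWithinAt he).clm_apply he').clm_apply he'

theorem continuousWithinAt_form_apply {A : E → E →L[ℝ] ℝ} {e e' : ℝ → E} {s : Set ℝ}
    {t : ℝ} (hA : ContDiffAt ℝ 2 A (e t)) (he : ContinuousWithinAt e s t)
    (he' : ContinuousWithinAt e' s t) :
    ContinuousWithinAt (fun r => A (e r) (e' r)) s t :=
  (hA.continuousAt.comp_continuousWithinAt he).clm_apply he'

theorem continuousWithinAt_fderiv_comp {F : Type*} [NormedAddCommGroup F] [NormedSpace ℝ F]
    {f : E → F} {e : ℝ → E} {s : Set ℝ} {t : ℝ} (hf : ContDiffAt ℝ 2 f (e t))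
    (he : ContinuousWithinAt e s t) : ContinuousWithinAt (fun r => fderiv ℝ f (e r)) s t :=
  (hf.fderiv_right (m := 1) (by norm_num)).continuousAt.comp_continuousWithinAt he

theorem continuousOn_magneticLagrangian {G : E → E →L[ℝ] E →L[ℝ] ℝ} {A : E → E →L[ℝ] ℝ}
    {e e' : ℝ → E} {s : Set ℝ} (hG : ∀ t ∈ s, ContDiffAt ℝ 2 G (e t))
    (hA : ∀ t ∈ s, ContDiffAt ℝ 2 A (e t)) (he : ContinuousOn e s) (he' : ContinuousOn e' s) :
    ContinuousOn (fun t => magneticLagrangian G A (e t) (e' t)) s := fun t ht =>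
  ((continuousWithinAt_metric_apply (hG t ht) (he t ht) (he' t ht)).const_mul _).sub
    (continuousWithinAt_form_apply (hA t ht) (he t ht) (he' t ht))

/-- The first variation along a solution of the Euler-Lagrange equation is a total derivative. -/
theorem EulerLagrangeAt.hasDerivAt_momentum {G : E → E →L[ℝ] E →L[ℝ] ℝ} {A : E → E →L[ℝ] ℝ}
    {c c' η : ℝ → E} {a ζ : E} {t : ℝ} (hG : DifferentiableAt ℝ G (c t))
    (hA : DifferentiableAt ℝ A (c t)) (hc : HasDerivAt c (c' t) t) (hc' : HasDerivAt c' a t)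
    (hη : HasDerivAt η ζ t) (h : EulerLagrangeAt G A (c t) (c' t) a) :
    HasDerivAt (fun s => G (c s) (c' s) (η s) - A (c s) (η s))
      ((1 / 2) * fderiv ℝ G (c t) (η t) (c' t) (c' t) - fderiv ℝ A (c t) (η t) (c' t) +
        (G (c t) (c' t) ζ - A (c t) ζ)) t := by
  have h1 : HasDerivAt (fun s => G (c s)) (fderiv ℝ G (c t) (c' t)) t :=
    HasFDerivAt.comp_hasDerivAt (E := E →L[ℝ] E →L[ℝ] ℝ) t hG.hasFDerivAt hc
  have h2 : HasDerivAt (fun s => A (c s)) (fderiv ℝ A (c t) (c' t)) t :=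
    HasFDerivAt.comp_hasDerivAt (E := E →L[ℝ] ℝ) t hA.hasFDerivAt hc
  have h3 := (h1.clm_apply₂ hc' hη).sub (h2.clm_apply hη)
  refine h3.congr_deriv ?_
  have := h (η t)
  linarith

/-- The first variation `Q` in the direction `e - c` is the derivative of the momentum paired with
`e - c`, which vanishes at both ends. The remainder is nonnegative after integration by
`integral_quadratic_nonneg`, `hmC` being the required shortness of the interval. -/
theorem action_le_of_eulerLagrange [CompleteSpace E]
    {G : E → E →L[ℝ] E →L[ℝ] ℝ} {A : E → E →L[ℝ] ℝ} {K : Set E} {m C V a b : ℝ}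
    {c c' c'' e e' : ℝ → E} (hab : a < b) (hsymm : ∀ y u w, G y u w = G y w u)
    (hGK : ∀ y ∈ K, ContDiffAt ℝ 2 G y) (hAK : ∀ y ∈ K, ContDiffAt ℝ 2 A y)
    (hG : ∀ y ∈ K, ∀ z ∈ K,
      ‖G z - G y - fderiv ℝ G y (z - y)‖ ≤ C * ‖z - y‖ ^ 2 ∧ ‖G z - G y‖ ≤ C * ‖z - y‖)
    (hA : ∀ y ∈ K, ∀ z ∈ K,
      ‖A z - A y - fderiv ℝ A y (z - y)‖ ≤ C * ‖z - y‖ ^ 2 ∧ ‖A z - A y‖ ≤ C * ‖z - y‖)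
    (hC : 0 ≤ C) (hm : ∀ y ∈ K, ∀ w, m * ‖w‖ ^ 2 ≤ G y w w)
    (hmC : C * (1 + V) ^ 2 * (b - a) * (1 + (b - a)) ≤ m / 2)
    (hcK : ∀ t ∈ Icc a b, c t ∈ K) (hc : ∀ t ∈ Icc a b, HasDerivAt c (c' t) t)
    (hc' : ∀ t ∈ Icc a b, HasDerivAt c' (c'' t) t) (hV : ∀ t ∈ Icc a b, ‖c' t‖ ≤ V)
    (hEL : ∀ t ∈ Icc a b, EulerLagrangeAt G A (c t) (c' t) (c'' t))
    (heK : ∀ t ∈ Icc a b, e t ∈ K) (he' : ContinuousOn e' (Icc a b))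
    (he : ∀ t ∈ Icc a b, HasDerivWithinAt e (e' t) (Icc a b) t)
    (hea : e a = c a) (heb : e b = c b) :
    ∫ t in a..b, magneticLagrangian G A (c t) (c' t) ≤
      ∫ t in a..b, magneticLagrangian G A (e t) (e' t) := by
  have hcc : ContinuousOn c (Icc a b) := fun t ht => (hc t ht).continuousAt.continuousWithinAt
  have hcc' : ContinuousOn c' (Icc a b) := fun t ht => (hc' t ht).continuousAt.continuousWithinAt
  have hec : ContinuousOn e (Icc a b) := fun t ht => (he t ht).continuousWithinAt
  have hII {h : ℝ → ℝ} (hh : ContinuousOn h (Icc a b)) : IntervalIntegrable h volume a b :=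
    ContinuousOn.intervalIntegrable (by rwa [uIcc_of_le hab.le])
  set Q : ℝ → ℝ := fun t => (1 / 2) * fderiv ℝ G (c t) (e t - c t) (c' t) (c' t) -
    fderiv ℝ A (c t) (e t - c t) (c' t) + (G (c t) (c' t) (e' t - c' t) - A (c t) (e' t - c' t))
    with hQ
  have hQc : ContinuousOn Q (Icc a b) := by
    intro t ht
    have i1 := hcc t ht
    have i2 := hcc' t ht
    have i3 := (hec t ht).sub i1
    have i4 := (he' t ht).sub i2
    have j1 := continuousWithinAt_fderiv_comp (hGK _ (hcK t ht)) i1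
    have j2 := continuousWithinAt_fderiv_comp (hAK _ (hcK t ht)) i1
    have j3 := (hGK _ (hcK t ht)).continuousAt.comp_continuousWithinAt i1
    have j4 := (hAK _ (hcK t ht)).continuousAt.comp_continuousWithinAt i1
    exact (((((j1.clm_apply i3).clm_apply i2).clm_apply i2).const_mul _).sub
      ((j2.clm_apply i3).clm_apply i2)).add (((j3.clm_apply i2).clm_apply i4).sub (j4.clm_apply i4))
  have hQ0 : ∫ t in a..b, Q t = 0 := by
    rw [intervalIntegral.integral_eq_sub_of_hasDerivAt_of_le
      (f := fun s => G (c s) (c' s) (e s - c s) - A (c s) (e s - c s)) hab.le ?_ ?_ (hII hQc)]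
    · simp [hea, heb]
    · intro t ht
      have i1 := hcc t ht
      have i2 := hcc' t ht
      have i3 := (hec t ht).sub i1
      have j3 := (hGK _ (hcK t ht)).continuousAt.comp_continuousWithinAt i1
      have j4 := (hAK _ (hcK t ht)).continuousAt.comp_continuousWithinAt i1
      exact ((j3.clm_apply i2).clm_apply i3).sub (j4.clm_apply i3)
    · intro t ht
      have ht' := Ioo_subset_Icc_self ht
      exact (hEL t ht').hasDerivAt_momentum ((hGK _ (hcK t ht')).differentiableAt (by simp))
        ((hAK _ (hcK t ht')).differentiableAt (by simp)) (hc t ht') (hc' t ht')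
        (((he t ht').hasDerivAt (Icc_mem_nhds ht.1 ht.2)).sub (hc t ht'))
  have hLc := hII (continuousOn_magneticLagrangian (fun t ht => hGK _ (hcK t ht))
    (fun t ht => hAK _ (hcK t ht)) hcc hcc')
  have hLe := hII (continuousOn_magneticLagrangian (fun t ht => hGK _ (heK t ht))
    (fun t ht => hAK _ (heK t ht)) hec he')
  have hP := integral_quadratic_nonneg (f := fun t => e t - c t) (f' := fun t => e' t - c' t) hab
    (he'.sub hcc') (fun t ht => (he t ht).sub (hc t ht).hasDerivWithinAt) (by simp [hea])
    (by positivity : 0 ≤ C * (1 + V) ^ 2) hmC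
  have hmono : ∫ t in a..b, (m / 2 * ‖e' t - c' t‖ ^ 2 -
      C * (1 + V) ^ 2 * (‖e t - c t‖ ^ 2 + ‖e t - c t‖ * ‖e' t - c' t‖)) ≤
      ∫ t in a..b, (magneticLagrangian G A (e t) (e' t) - magneticLagrangian G A (c t) (c' t) - Q t) := by
    apply intervalIntegral.integral_mono_on hab.le (hII (by fun_prop)) ((hLe.sub hLc).sub (hII hQc))
    intro t ht
    exact magneticLagrangian_sub_ge (hsymm _) (hG _ (hcK t ht) _ (heK t ht))
      (hA _ (hcK t ht) _ (heK t ht)) hC (hm _ (heK t ht)) (hV t ht)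
  rw [intervalIntegral.integral_sub (hLe.sub hLc) (hII hQc), intervalIntegral.integral_sub hLe hLc,
    hQ0] at hmono
  linarith

/-- The last two clauses cover the two kinds of competitor. One that stays in the ball is compared
by action. One that reaches the boundary at a time `τ` is compared by energy alone, on `[a, τ]`
only, so nothing is asked of it after `τ`. -/
theorem exists_short_arcs_minimizing [FiniteDimensional ℝ E]
    {G : E → E →L[ℝ] E →L[ℝ] ℝ} {A : E → E →L[ℝ] ℝ} {c : ℝ → E} {t₀ : ℝ} {U : Set E}
    (hU : U ∈ 𝓝 (c t₀)) (hG : ContDiffAt ℝ 2 G (c t₀)) (hA : ContDiffAt ℝ 2 A (c t₀))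
    (hsymm : ∀ y u w, G y u w = G y w u) (hpos : ∀ v, v ≠ 0 → 0 < G (c t₀) v v)
    (hc : ContDiffAt ℝ 2 c t₀)
    (hEL : ∀ᶠ t in 𝓝 t₀, EulerLagrangeAt G A (c t) (deriv c t) (deriv (deriv c) t)) :
    ∃ R > 0, Metric.closedBall (c t₀) R ⊆ U ∧ ∃ ε > 0, ∀ a b, t₀ - ε < a → a < b → b < t₀ + ε →
      (∀ t ∈ Icc a b, c t ∈ Metric.ball (c t₀) R) ∧
      (∀ e e' : ℝ → E, (∀ t ∈ Icc a b, e t ∈ Metric.closedBall (c t₀) R) →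
        ContinuousOn e' (Icc a b) → (∀ t ∈ Icc a b, HasDerivWithinAt e (e' t) (Icc a b) t) →
        e a = c a → e b = c b →
        ∫ t in a..b, magneticLagrangian G A (c t) (deriv c t) ≤
          ∫ t in a..b, magneticLagrangian G A (e t) (e' t)) ∧
      (∀ (e e' : ℝ → E) (τ : ℝ), a < τ → τ ≤ b →
        (∀ t ∈ Icc a τ, e t ∈ Metric.closedBall (c t₀) R) →
        ContinuousOn e' (Icc a τ) → (∀ t ∈ Icc a τ, HasDerivWithinAt e (e' t) (Icc a τ) t) →
        e a = c a → e τ ∉ Metric.ball (c t₀) R →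
        ∫ t in a..b, (1 / 2) * G (c t) (deriv c t) (deriv c t) ≤
          ∫ t in a..τ, (1 / 2) * G (e t) (e' t) (e' t)) := by
  obtain ⟨C₁, hC₁, hT₁⟩ := exists_taylor_bound hG
  obtain ⟨C₂, hC₂, hT₂⟩ := exists_taylor_bound hA
  obtain ⟨m, hm, hcoer⟩ := exists_coercive_bound hG hpos
  have hG2 : ∀ᶠ y in 𝓝 (c t₀), ContDiffAt ℝ 2 G y := hG.eventually (by simp)
  have hA2 : ∀ᶠ y in 𝓝 (c t₀), ContDiffAt ℝ 2 A y := hA.eventually (by simp)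
  have hev {s : Set E} (hs : s ∈ 𝓝 (c t₀)) :
      ∀ᶠ R in 𝓝[>] (0 : ℝ), Metric.closedBall (c t₀) R ⊆ s :=
    nhdsWithin_le_nhds (eventually_closedBall_subset hs)
  obtain ⟨R, hTR₁, hTR₂, hcR, hGR, hAR, hUR, hR⟩ := (hT₁.and (hT₂.and (hcoer.and
    ((hev hG2).and ((hev hA2).and ((hev hU).and
    (self_mem_nhdsWithin : ∀ᶠ R in 𝓝[>] (0 : ℝ), 0 < R))))))).exists
  set V := ‖deriv c t₀‖ + 1
  set B := (1 / 2) * G (c t₀) (deriv c t₀) (deriv c t₀) + 1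
  set C := max C₁ C₂
  have hC : 0 ≤ C := hC₁.trans (le_max_left _ _)
  have hc1 : ContDiffAt ℝ 1 (deriv c) t₀ := by
    have : ContDiffAt ℝ 1 (fun t => fderiv ℝ c t 1) t₀ :=
      (hc.fderiv_right (m := 1) (by norm_num)).clm_apply contDiffAt_const
    exact this
  have ev1 : ∀ᶠ t in 𝓝 t₀, HasDerivAt c (deriv c t) t :=
    (hc.eventually (by simp)).mono fun t ht => (ht.differentiableAt (by simp)).hasDerivAt
  have ev2 : ∀ᶠ t in 𝓝 t₀, HasDerivAt (deriv c) (deriv (deriv c) t) t :=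
    (hc1.eventually (by simp)).mono fun t ht => (ht.differentiableAt (by simp)).hasDerivAt
  have ev3 : ∀ᶠ t in 𝓝 t₀, ‖deriv c t‖ < V :=
    hc1.continuousAt.norm.eventually_lt continuousAt_const (by simp [V])
  -- Half the radius, so that a curve starting on `c` must travel at least `R / 2` to leave the ball
  -- of radius `R`.
  have ev4 : ∀ᶠ t in 𝓝 t₀, c t ∈ Metric.ball (c t₀) (R / 2) :=
    hc.continuousAt (Metric.ball_mem_nhds _ (by positivity))
  have ev5 : ∀ᶠ t in 𝓝 t₀, (1 / 2) * G (c t) (deriv c t) (deriv c t) < B := by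
    have h1 := continuousWithinAt_metric_apply (s := univ) hG hc.continuousAt.continuousWithinAt
      hc1.continuousAt.continuousWithinAt
    have h2 := (h1.const_mul (1 / 2)).continuousAt univ_mem
    exact h2.eventually_lt continuousAt_const (by simp [B])
  obtain ⟨ε₀, hε₀, hball⟩ := Metric.eventually_nhds_iff_ball.1
    (ev1.and (ev2.and (ev3.and (ev4.and (ev5.and hEL)))))
  -- With `2 * ε` bounding `b - a`, this is the shortness needed for the Poincaré inequality.
  have hs1 : ∀ᶠ ε in 𝓝[>] (0 : ℝ), C * (1 + V) ^ 2 * (2 * ε) * (1 + 2 * ε) < m / 2 := by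
    have : ContinuousAt (fun ε : ℝ => C * (1 + V) ^ 2 * (2 * ε) * (1 + 2 * ε)) 0 := by fun_prop
    exact nhdsWithin_le_nhds (this.eventually_lt continuousAt_const (by simpa using hm))
  -- The arc of `c` has energy at most `B * (b - a)`, while an escaping curve has at least `(m / 2)
  -- * (R / 2) ^ 2 / (b - a)`; this makes the former no larger.
  have hs2 : ∀ᶠ ε in 𝓝[>] (0 : ℝ), 8 * B * (2 * ε) ^ 2 < m * R ^ 2 := by
    have : ContinuousAt (fun ε : ℝ => 8 * B * (2 * ε) ^ 2) 0 := by fun_prop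
    refine nhdsWithin_le_nhds (this.eventually_lt continuousAt_const ?_)
    simp only [mul_zero, ne_eq, OfNat.ofNat_ne_zero, not_false_eq_true, zero_pow]
    positivity
  obtain ⟨ε, h1, h2, h3⟩ := (hs1.and (hs2.and (Ioc_mem_nhdsGT hε₀ :
    ∀ᶠ ε in 𝓝[>] (0 : ℝ), ε ∈ Ioc 0 ε₀))).exists
  refine ⟨R, hR, hUR, ε, h3.1, fun a b ha hab hb => ?_⟩
  have hI (t : ℝ) (ht : t ∈ Icc a b) := hball t (by
    rw [Metric.mem_ball, Real.dist_eq, abs_lt]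
    constructor <;> linarith [ht.1, ht.2, h3.2])
  have hba : 0 < b - a := sub_pos.2 hab
  have hbε : b - a ≤ 2 * ε := by linarith
  have hcK (t : ℝ) (ht : t ∈ Icc a b) : c t ∈ Metric.ball (c t₀) (R / 2) := (hI t ht).2.2.2.1
  have hcK' (t : ℝ) (ht : t ∈ Icc a b) : c t ∈ Metric.ball (c t₀) R :=
    Metric.ball_subset_ball (by linarith) (hcK t ht)
  have hV0 : 0 ≤ V := by positivity
  refine ⟨hcK', ?_, ?_⟩
  · intro e e' heK he' he hea heb
    refine action_le_of_eulerLagrange (K := Metric.closedBall (c t₀) R) (C := C) (V := V) (m := m)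
      (c'' := deriv (deriv c))
      hab hsymm (fun y hy => hGR hy) (fun y hy => hAR hy) ?_ ?_ hC hcR ?_
      (fun t ht => Metric.ball_subset_closedBall (hcK' t ht)) (fun t ht => (hI t ht).1)
      (fun t ht => (hI t ht).2.1) (fun t ht => (hI t ht).2.2.1.le)
      (fun t ht => (hI t ht).2.2.2.2.2) heK he' he hea heb
    · intro y hy z hz
      obtain ⟨i, j⟩ := hTR₁ y hy z hz
      exact ⟨i.trans (by gcongr; exact le_max_left _ _), j.trans (by gcongr; exact le_max_left _ _)⟩
    · intro y hy z hz
      obtain ⟨i, j⟩ := hTR₂ y hy z hz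
      exact ⟨i.trans (by gcongr; exact le_max_right _ _),
        j.trans (by gcongr; exact le_max_right _ _)⟩
    · have hε := h3.1
      refine le_trans ?_ h1.le
      gcongr
  · intro e e' τ haτ hτb heK he' he hea heτ
    have hec : ContinuousOn e (Icc a τ) := fun t ht => (he t ht).continuousWithinAt
    have hup : ∫ t in a..b, (1 / 2) * G (c t) (deriv c t) (deriv c t) ≤ ∫ t in a..b, B := by
      apply intervalIntegral.integral_mono_on hab.le _ (by simp)
        (fun t ht => (hI t ht).2.2.2.2.1.le)
      apply ContinuousOn.intervalIntegrable
      rw [uIcc_of_le hab.le]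
      intro t ht
      exact (continuousWithinAt_metric_apply (hGR (Metric.ball_subset_closedBall (hcK' t ht)))
        (hI t ht).1.continuousAt.continuousWithinAt
        (hI t ht).2.1.continuousAt.continuousWithinAt).const_mul _
    rw [intervalIntegral.integral_const, smul_eq_mul] at hup
    have hlow : ∫ t in a..τ, m / 2 * ‖e' t‖ ^ 2 ≤ ∫ t in a..τ, (1 / 2) * G (e t) (e' t) (e' t) := by
      apply intervalIntegral.integral_mono_on haτ.le
      · exact ContinuousOn.intervalIntegrable (by rw [uIcc_of_le haτ.le]; fun_prop)
      · apply ContinuousOn.intervalIntegrable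
        rw [uIcc_of_le haτ.le]
        intro t ht
        exact (continuousWithinAt_metric_apply (hGR (heK t ht)) (hec t ht) (he' t ht)).const_mul _
      · intro t ht
        linarith [hcR _ (heK t ht) (e' t)]
    rw [intervalIntegral.integral_const_mul] at hlow
    have hn := norm_sub_le_integral_norm_deriv he' he (right_mem_Icc.2 haτ.le)
    have hsq := sq_integral_le haτ he'.norm
    have hR2 : R / 2 ≤ ‖e τ - e a‖ := by
      have i1 : R ≤ dist (e τ) (c t₀) := not_lt.1 heτ
      have i2 : dist (c a) (c t₀) < R / 2 := hcK a (left_mem_Icc.2 hab.le)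
      have i3 := dist_triangle (e τ) (c a) (c t₀)
      rw [hea, ← dist_eq_norm]
      linarith
    set J := ∫ t in a..τ, ‖e' t‖ ^ 2
    have hJ : 0 ≤ J := intervalIntegral.integral_nonneg haτ.le fun _ _ => sq_nonneg _
    have hRJ : (R / 2) ^ 2 ≤ (b - a) * J := by
      calc (R / 2) ^ 2 ≤ (∫ t in a..τ, ‖e' t‖) ^ 2 := by
            have := hR2.trans hn
            gcongr
        _ ≤ (τ - a) * J := hsq
        _ ≤ (b - a) * J := by gcongr
    have hB0 : 0 ≤ B := by
      have := hcR (c t₀) (Metric.mem_closedBall_self hR.le) (deriv c t₀)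
      have : 0 ≤ G (c t₀) (deriv c t₀) (deriv c t₀) := le_trans (by positivity) this
      positivity
    have h4 : 8 * B * (b - a) ^ 2 ≤ m * R ^ 2 := le_trans (by gcongr) h2.le
    have h5 : (b - a) * ((b - a) * B) ≤ (b - a) * (m / 2 * J) := by nlinarith
    have h6 := le_of_mul_le_mul_left h5 hba
    linarith

end ActionMinimization

/-! ### The metric, the one-form and derivatives of maps, read in a chart. -/

section ChartRepresentations

variable {E : Type*} [NormedAddCommGroup E] [NormedSpace ℝ E]
  {M : Type*} [TopologicalSpace M] [ChartedSpace E M] [IsManifold 𝓘(ℝ, E) ∞ M]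
  {F : Type*} [NormedAddCommGroup F] [NormedSpace ℝ F]

theorem mdifferentiableAt_extChartAt_symm {x : M} {y : E} (hy : y ∈ (extChartAt 𝓘(ℝ, E) x).target) :
    MDifferentiableAt 𝓘(ℝ, E) 𝓘(ℝ, E) (extChartAt 𝓘(ℝ, E) x).symm y :=
  ((contMDiffOn_extChartAt_symm (n := ∞) x).contMDiffAt
    ((isOpen_extChartAt_target x).mem_nhds hy)).mdifferentiableAt (by simp)

theorem chartInvDeriv_self (x : M) :
    (chartInvDeriv x (extChartAt 𝓘(ℝ, E) x x) : E →L[ℝ] E) = ContinuousLinearMap.id ℝ E := by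
  have h := mdifferentiableAt_extChartAt_symm (mem_extChartAt_target (I := 𝓘(ℝ, E)) x)
  have h1 : (chartInvDeriv x (extChartAt 𝓘(ℝ, E) x x) : E →L[ℝ] E)
      = fderivWithin ℝ (writtenInExtChartAt 𝓘(ℝ, E) 𝓘(ℝ, E) (extChartAt 𝓘(ℝ, E) x x)
          (extChartAt 𝓘(ℝ, E) x).symm) (range 𝓘(ℝ, E)) (extChartAt 𝓘(ℝ, E) x x) :=
    h.mfderiv
  rw [h1]
  simp only [modelWithCornersSelf_coe, range_id, fderivWithin_univ]
  have h2 : writtenInExtChartAt 𝓘(ℝ, E) 𝓘(ℝ, E) (extChartAt 𝓘(ℝ, E) x x)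
          (extChartAt 𝓘(ℝ, E) x).symm =ᶠ[nhds (extChartAt 𝓘(ℝ, E) x x)] id := by
    filter_upwards [extChartAt_target_mem_nhds (I := 𝓘(ℝ, E)) x] with z hz
    have h3 := (extChartAt 𝓘(ℝ, E) x).right_inv hz
    simp only [writtenInExtChartAt, Function.comp, id, extChartAt_to_inv]
    exact h3
  rw [h2.fderiv_eq, fderiv_id]

theorem hasMFDerivWithinAt_of_chart {f : F → M} {s : Set F} {y : F} {x : M}
    (hf : MDifferentiableWithinAt 𝓘(ℝ, F) 𝓘(ℝ, E) f s y) (hx : f y ∈ (extChartAt 𝓘(ℝ, E) x).source) :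
    DifferentiableWithinAt ℝ (fun z => extChartAt 𝓘(ℝ, E) x (f z)) s y ∧
    ∀ D : F →L[ℝ] E, HasFDerivWithinAt (fun z => extChartAt 𝓘(ℝ, E) x (f z)) D s y →
      HasMFDerivWithinAt 𝓘(ℝ, F) 𝓘(ℝ, E) f s y
        ((chartInvDeriv x (extChartAt 𝓘(ℝ, E) x (f y)) : E →L[ℝ] E).comp D : F →L[ℝ] E) := by
  constructor
  · have h1 : MDifferentiableAt 𝓘(ℝ, E) 𝓘(ℝ, E) (extChartAt 𝓘(ℝ, E) x) (f y) :=
      mdifferentiableAt_extChartAt (by simpa using hx)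
    have := h1.comp_mdifferentiableWithinAt y hf
    exact this.differentiableWithinAt
  · intro D hD
    have hs := (mdifferentiableAt_extChartAt_symm ((extChartAt 𝓘(ℝ, E) x).map_source hx)).hasMFDerivAt
    have h2 := hs.comp_hasMFDerivWithinAt y hD.hasMFDerivWithinAt
    refine h2.congr_of_eventuallyEq ?_ ((extChartAt 𝓘(ℝ, E) x).left_inv hx).symm
    have := hf.continuousWithinAt.preimage_mem_nhdsWithin
      ((isOpen_extChartAt_source (I := 𝓘(ℝ, E)) x).mem_nhds hx)
    filter_upwards [this] with z hz
    exact ((extChartAt 𝓘(ℝ, E) x).left_inv hz).symm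

theorem metricInChart_apply (g : SmoothMetric E M) {x q : M}
    (hq : q ∈ (extChartAt 𝓘(ℝ, E) x).source) (u w : E) :
    metricInChart g x (extChartAt 𝓘(ℝ, E) x q) u w =
      g.inner q (chartInvDeriv x (extChartAt 𝓘(ℝ, E) x q) u : E)
        (chartInvDeriv x (extChartAt 𝓘(ℝ, E) x q) w : E) := by
  -- Every tangent space is definitionally `E`; forgetting the dependence on the base point lets
  -- `left_inv` be substituted.
  let G : M → E → E → ℝ := fun q u w => g.inner q u w
  exact congrArg (fun p => G p (chartInvDeriv x (extChartAt 𝓘(ℝ, E) x q) u)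
    (chartInvDeriv x (extChartAt 𝓘(ℝ, E) x q) w)) ((extChartAt 𝓘(ℝ, E) x).left_inv hq)

theorem oneFormInChart_apply (α : SmoothOneForm E M) {x q : M}
    (hq : q ∈ (extChartAt 𝓘(ℝ, E) x).source) (u : E) :
    oneFormInChart α x (extChartAt 𝓘(ℝ, E) x q) u =
      α q (chartInvDeriv x (extChartAt 𝓘(ℝ, E) x q) u : E) := by
  let G : M → E → ℝ := fun q u => α q u
  exact congrArg (fun p => G p (chartInvDeriv x (extChartAt 𝓘(ℝ, E) x q) u))
    ((extChartAt 𝓘(ℝ, E) x).left_inv hq)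

theorem metricInChart_self (g : SmoothMetric E M) (x : M) (u w : E) :
    metricInChart g x (extChartAt 𝓘(ℝ, E) x x) u w = g.inner x u w := by
  rw [metricInChart_apply g (mem_extChartAt_source x)]
  have h := chartInvDeriv_self (E := E) x
  have h' (u : E) : (chartInvDeriv x (extChartAt 𝓘(ℝ, E) x x) u : E) = u :=
    congrArg (fun L : E →L[ℝ] E => L u) h
  exact congrArg₂ (fun a b : E => g.inner x a b) (h' u) (h' w)

theorem metricInChart_symm (g : SmoothMetric E M) (x : M) (y u w : E) :
    metricInChart g x y u w = metricInChart g x y w u :=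
  g.symm ((extChartAt 𝓘(ℝ, E) x).symm y) (chartInvDeriv x y u) (chartInvDeriv x y w)

theorem contMDiffOn_chartInvDeriv (x : M) (u : E) :
    ContMDiffOn 𝓘(ℝ, E) 𝓘(ℝ, E).tangent ∞
      (fun y => (TotalSpace.mk' E ((extChartAt 𝓘(ℝ, E) x).symm y) (chartInvDeriv x y u) :
        TangentBundle 𝓘(ℝ, E) M)) (extChartAt 𝓘(ℝ, E) x).target := by
  have ho := isOpen_extChartAt_target (I := 𝓘(ℝ, E)) x
  have h := (contMDiffOn_extChartAt_symm (I := 𝓘(ℝ, E)) (n := ∞) x).contMDiffOn_tangentMapWithin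
    (m := ∞) (by simp) ho.uniqueMDiffOn
  have hc : ContMDiff 𝓘(ℝ, E) 𝓘(ℝ, E).tangent ∞
      (fun y : E => (TotalSpace.mk' E y u : TangentBundle 𝓘(ℝ, E) E)) := by
    exact contMDiff_vectorSpace_iff_contDiff.2 contDiff_const
  refine (h.comp hc.contMDiffOn (fun y hy => hy)).congr ?_
  intro y hy
  simp only [Function.comp, tangentMapWithin, chartInvDeriv]
  rw [mfderivWithin_of_isOpen ho hy]
  rfl

variable [FiniteDimensional ℝ E]

theorem contDiffOn_metricInChart (g : SmoothMetric E M) (x : M) :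
    ContDiffOn ℝ ∞ (metricInChart g x) (extChartAt 𝓘(ℝ, E) x).target := by
  rw [contDiffOn_clm_apply]
  intro u
  rw [contDiffOn_clm_apply]
  intro w y hy
  have hg := g.contMDiff.contMDiffAt.comp_contMDiffWithinAt y
    (contMDiffOn_extChartAt_symm (I := 𝓘(ℝ, E)) (n := ∞) x y hy)
  have := ContMDiffWithinAt.clm_bundle_apply₂ (F₁ := E) (F₂ := E) (F₃ := ℝ) (E₃ := Trivial M ℝ) hg
    (contMDiffOn_chartInvDeriv x u y hy) (contMDiffOn_chartInvDeriv x w y hy)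
  rw [contMDiffWithinAt_totalSpace] at this
  exact this.2.contDiffWithinAt

theorem contDiffOn_oneFormInChart (α : SmoothOneForm E M) (x : M) :
    ContDiffOn ℝ ∞ (oneFormInChart α x) (extChartAt 𝓘(ℝ, E) x).target := by
  rw [contDiffOn_clm_apply]
  intro u y hy
  have hg := α.contMDiff.contMDiffAt.comp_contMDiffWithinAt y
    (contMDiffOn_extChartAt_symm (I := 𝓘(ℝ, E)) (n := ∞) x y hy)
  have := ContMDiffWithinAt.clm_bundle_apply (F₁ := E) (F₂ := ℝ) (E₂ := Trivial M ℝ) hg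
    (contMDiffOn_chartInvDeriv x u y hy)
  rw [contMDiffWithinAt_totalSpace] at this
  exact this.2.contDiffWithinAt

end ChartRepresentations

/-! ### Velocities in charts and the Euler-Lagrange equation of a magnetic geodesic. -/

section Curves

open Filter Topology

set_option synthInstance.maxHeartbeats 200000

variable {E : Type*} [NormedAddCommGroup E] [NormedSpace ℝ E]
  {M : Type*} [TopologicalSpace M] [ChartedSpace E M]

theorem velocityWithin_univ (γ : ℝ → M) (t : ℝ) : velocityWithin (E := E) γ univ t = velocity γ t := by
  simp only [velocityWithin, velocity, mfderivWithin_univ]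

theorem velocityWithin_eq_velocity {γ : ℝ → M} {s : Set ℝ} {t : ℝ}
    (hγ : MDifferentiableAt 𝓘(ℝ, ℝ) 𝓘(ℝ, E) γ t) (hs : UniqueDiffWithinAt ℝ s t) :
    velocityWithin (E := E) γ s t = velocity γ t := by
  simp only [velocityWithin, velocity, mfderivWithin_eq_mfderiv hs.uniqueMDiffWithinAt hγ]

theorem eventually_mem_chart_source {γ : ℝ → M} {t : ℝ} {x : M}
    (hγ : ContMDiff 𝓘(ℝ, ℝ) 𝓘(ℝ, E) ∞ γ) (hx : γ t ∈ (extChartAt 𝓘(ℝ, E) x).source) :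
    ∀ᶠ s in 𝓝 t, γ s ∈ (extChartAt 𝓘(ℝ, E) x).source :=
  hγ.continuous.continuousAt ((isOpen_extChartAt_source x).mem_nhds hx)

variable [IsManifold 𝓘(ℝ, E) ∞ M]

theorem velocityWithin_eq_of_chart {δ : ℝ → M} {s : Set ℝ} {t : ℝ} {x : M}
    (hδ : MDifferentiableWithinAt 𝓘(ℝ, ℝ) 𝓘(ℝ, E) δ s t) (hs : UniqueDiffWithinAt ℝ s t)
    (hx : δ t ∈ (extChartAt 𝓘(ℝ, E) x).source) :
    (velocityWithin δ s t : E) = (chartInvDeriv x (extChartAt 𝓘(ℝ, E) x (δ t)) : E →L[ℝ] E)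
      (derivWithin (fun r => extChartAt 𝓘(ℝ, E) x (δ r)) s t) := by
  obtain ⟨h1, h2⟩ := hasMFDerivWithinAt_of_chart hδ hx
  have h3 := (h2 _ h1.hasFDerivWithinAt).mfderivWithin hs.uniqueMDiffWithinAt
  exact congrArg (fun L : ℝ →L[ℝ] E => L 1) h3

theorem metric_velocityWithin (g : SmoothMetric E M) {δ : ℝ → M} {s : Set ℝ} {t : ℝ} {x : M}
    (hδ : MDifferentiableWithinAt 𝓘(ℝ, ℝ) 𝓘(ℝ, E) δ s t) (hs : UniqueDiffWithinAt ℝ s t)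
    (hx : δ t ∈ (extChartAt 𝓘(ℝ, E) x).source) :
    g.inner (δ t) (velocityWithin δ s t) (velocityWithin δ s t) =
      metricInChart g x (extChartAt 𝓘(ℝ, E) x (δ t))
        (derivWithin (fun r => extChartAt 𝓘(ℝ, E) x (δ r)) s t)
        (derivWithin (fun r => extChartAt 𝓘(ℝ, E) x (δ r)) s t) := by
  rw [metricInChart_apply g hx]
  exact congrArg (fun v : E => g.inner (δ t) v v) (velocityWithin_eq_of_chart hδ hs hx)

theorem oneForm_velocityWithin (α : SmoothOneForm E M) {δ : ℝ → M} {s : Set ℝ} {t : ℝ} {x : M}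
    (hδ : MDifferentiableWithinAt 𝓘(ℝ, ℝ) 𝓘(ℝ, E) δ s t) (hs : UniqueDiffWithinAt ℝ s t)
    (hx : δ t ∈ (extChartAt 𝓘(ℝ, E) x).source) :
    α (δ t) (velocityWithin δ s t) =
      oneFormInChart α x (extChartAt 𝓘(ℝ, E) x (δ t))
        (derivWithin (fun r => extChartAt 𝓘(ℝ, E) x (δ r)) s t) := by
  rw [oneFormInChart_apply α hx]
  exact congrArg (fun v : E => α (δ t) v) (velocityWithin_eq_of_chart hδ hs hx)

theorem metric_velocity (g : SmoothMetric E M) {γ : ℝ → M} {t : ℝ} {x : M}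
    (hγ : MDifferentiableAt 𝓘(ℝ, ℝ) 𝓘(ℝ, E) γ t) (hx : γ t ∈ (extChartAt 𝓘(ℝ, E) x).source) :
    g.inner (γ t) (velocity γ t) (velocity γ t) =
      metricInChart g x (extChartAt 𝓘(ℝ, E) x (γ t))
        (deriv (fun r => extChartAt 𝓘(ℝ, E) x (γ r)) t)
        (deriv (fun r => extChartAt 𝓘(ℝ, E) x (γ r)) t) := by
  have := metric_velocityWithin g hγ.mdifferentiableWithinAt uniqueDiffWithinAt_univ hx
  rwa [velocityWithin_univ, derivWithin_univ] at this

theorem oneForm_velocity (α : SmoothOneForm E M) {γ : ℝ → M} {t : ℝ} {x : M}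
    (hγ : MDifferentiableAt 𝓘(ℝ, ℝ) 𝓘(ℝ, E) γ t) (hx : γ t ∈ (extChartAt 𝓘(ℝ, E) x).source) :
    α (γ t) (velocity γ t) = oneFormInChart α x (extChartAt 𝓘(ℝ, E) x (γ t))
      (deriv (fun r => extChartAt 𝓘(ℝ, E) x (γ r)) t) := by
  have := oneForm_velocityWithin α hγ.mdifferentiableWithinAt uniqueDiffWithinAt_univ hx
  rwa [velocityWithin_univ, derivWithin_univ] at this

theorem velocity_eq_deriv_chart {γ : ℝ → M} {t : ℝ} (hγ : MDifferentiableAt 𝓘(ℝ, ℝ) 𝓘(ℝ, E) γ t) :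
    (velocity γ t : E) = deriv (fun r => extChartAt 𝓘(ℝ, E) (γ t) (γ r)) t := by
  have h := velocityWithin_eq_of_chart hγ.mdifferentiableWithinAt uniqueDiffWithinAt_univ
    (mem_extChartAt_source (I := 𝓘(ℝ, E)) (γ t))
  rw [velocityWithin_univ, derivWithin_univ] at h
  exact h.trans (congrArg (fun L : E →L[ℝ] E => L _) (chartInvDeriv_self (E := E) (γ t)))

theorem contDiffAt_chart_comp {γ : ℝ → M} {t : ℝ} {x : M} (hγ : ContMDiff 𝓘(ℝ, ℝ) 𝓘(ℝ, E) ∞ γ)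
    (hx : γ t ∈ (extChartAt 𝓘(ℝ, E) x).source) :
    ContDiffAt ℝ ∞ (fun r => extChartAt 𝓘(ℝ, E) x (γ r)) t :=
  ((contMDiffAt_extChartAt' (by simpa using hx)).comp t hγ.contMDiffAt).contDiffAt

/-- Change of coordinates from the preferred chart at `x` to the preferred chart at `q`. -/
theorem chartInvDeriv_transition {x q : M} {z : E} (hz : z ∈ (extChartAt 𝓘(ℝ, E) x).target)
    (hq : (extChartAt 𝓘(ℝ, E) x).symm z ∈ (extChartAt 𝓘(ℝ, E) q).source) (u : E) :
    (chartInvDeriv x z u : E) =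
      (chartInvDeriv q (extChartAt 𝓘(ℝ, E) q ((extChartAt 𝓘(ℝ, E) x).symm z)) : E →L[ℝ] E)
        (fderiv ℝ (fun y => extChartAt 𝓘(ℝ, E) q ((extChartAt 𝓘(ℝ, E) x).symm y)) z u) := by
  obtain ⟨h1, h2⟩ := hasMFDerivWithinAt_of_chart (s := univ)
    (mdifferentiableAt_extChartAt_symm hz).mdifferentiableWithinAt hq
  have h3 := (h2 _ (h1.differentiableAt univ_mem).hasFDerivAt.hasFDerivWithinAt).hasMFDerivAt
    univ_mem
  exact congrArg (fun L : E →L[ℝ] E => L u) h3.mfderiv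

theorem metricInChart_transition (g : SmoothMetric E M) {x q : M} {z : E}
    (hz : z ∈ (extChartAt 𝓘(ℝ, E) x).target)
    (hq : (extChartAt 𝓘(ℝ, E) x).symm z ∈ (extChartAt 𝓘(ℝ, E) q).source) (u w : E) :
    metricInChart g x z u w =
      metricInChart g q (extChartAt 𝓘(ℝ, E) q ((extChartAt 𝓘(ℝ, E) x).symm z))
        (fderiv ℝ (fun y => extChartAt 𝓘(ℝ, E) q ((extChartAt 𝓘(ℝ, E) x).symm y)) z u)
        (fderiv ℝ (fun y => extChartAt 𝓘(ℝ, E) q ((extChartAt 𝓘(ℝ, E) x).symm y)) z w) := by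
  rw [metricInChart_apply g hq]
  exact congrArg₂ (fun a b : E => g.inner ((extChartAt 𝓘(ℝ, E) x).symm z) a b)
    (chartInvDeriv_transition hz hq u) (chartInvDeriv_transition hz hq w)

theorem oneFormInChart_transition (α : SmoothOneForm E M) {x q : M} {z : E}
    (hz : z ∈ (extChartAt 𝓘(ℝ, E) x).target)
    (hq : (extChartAt 𝓘(ℝ, E) x).symm z ∈ (extChartAt 𝓘(ℝ, E) q).source) (u : E) :
    oneFormInChart α x z u =
      oneFormInChart α q (extChartAt 𝓘(ℝ, E) q ((extChartAt 𝓘(ℝ, E) x).symm z))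
        (fderiv ℝ (fun y => extChartAt 𝓘(ℝ, E) q ((extChartAt 𝓘(ℝ, E) x).symm y)) z u) := by
  rw [oneFormInChart_apply α hq]
  exact congrArg (fun a : E => α ((extChartAt 𝓘(ℝ, E) x).symm z) a)
    (chartInvDeriv_transition hz hq u)

variable [FiniteDimensional ℝ E]

theorem contDiffAt_metricInChart (g : SmoothMetric E M) {x : M} {y : E}
    (hy : y ∈ (extChartAt 𝓘(ℝ, E) x).target) : ContDiffAt ℝ 2 (metricInChart g x) y :=
  ((contDiffOn_metricInChart g x).contDiffAt ((isOpen_extChartAt_target x).mem_nhds hy)).of_le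
    ENat.LEInfty.out

theorem contDiffAt_oneFormInChart (α : SmoothOneForm E M) {x : M} {y : E}
    (hy : y ∈ (extChartAt 𝓘(ℝ, E) x).target) : ContDiffAt ℝ 2 (oneFormInChart α x) y :=
  ((contDiffOn_oneFormInChart α x).contDiffAt ((isOpen_extChartAt_target x).mem_nhds hy)).of_le
    ENat.LEInfty.out

/-- The equation of motion paired with `w`. At the centre of its own chart the coordinate metric is
`g` itself, so the Christoffel functional and `dOneForm` unfold to the coordinate terms. -/
theorem IsMagneticGeodesic.eulerLagrangeAt_self {g : SmoothMetric E M} {α : SmoothOneForm E M}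
    {γ : ℝ → M} (hγ : IsMagneticGeodesic g α γ) (t : ℝ) :
    EulerLagrangeAt (metricInChart g (γ t)) (oneFormInChart α (γ t))
      (extChartAt 𝓘(ℝ, E) (γ t) (γ t)) (deriv (fun r => extChartAt 𝓘(ℝ, E) (γ t) (γ r)) t)
      (deriv (deriv (fun r => extChartAt 𝓘(ℝ, E) (γ t) (γ r))) t) := by
  intro w
  set c : ℝ → E := fun r => extChartAt 𝓘(ℝ, E) (γ t) (γ r)
  have h := hγ.equation t
  have h1 : g.inner (γ t) (lorentzForce g α (γ t) (velocity γ t)) w =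
      dOneForm α (γ t) (velocity γ t) w := inner_sharp _ _ _ _
  have hv : (velocity γ t : E) = deriv c t :=
    velocity_eq_deriv_chart (hγ.smooth.mdifferentiable (by simp) t)
  have h2 : dOneForm α (γ t) (velocity γ t) w =
      fderiv ℝ (oneFormInChart α (γ t)) (extChartAt 𝓘(ℝ, E) (γ t) (γ t)) (deriv c t) w -
      fderiv ℝ (oneFormInChart α (γ t)) (extChartAt 𝓘(ℝ, E) (γ t) (γ t)) w (deriv c t) := by
    exact (congrArg (fun v : E => dOneForm α (γ t) v w) hv)
  have h3 : g.inner (γ t) (covariantAcceleration g γ t) w =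
      metricInChart g (γ t) (extChartAt 𝓘(ℝ, E) (γ t) (γ t)) (deriv (deriv c) t) w +
      christoffelFirst g (γ t) (deriv c t) (deriv c t) w := by
    rw [metricInChart_self]
    let Γ : E →L[ℝ] ℝ := christoffelFirst g (γ t) (deriv c t) (deriv c t)
    have i1 := inner_sharp g (γ t) Γ w
    let B : E →L[ℝ] E →L[ℝ] ℝ := g.inner (γ t)
    let S : E := sharp g (γ t) Γ
    have i2 : B (deriv (deriv c) t + S) w = B (deriv (deriv c) t) w + B S w := by simp
    exact i2.trans (congrArg (fun r : ℝ => B (deriv (deriv c) t) w + r) i1)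
  have hG : DifferentiableAt ℝ (metricInChart g (γ t)) (extChartAt 𝓘(ℝ, E) (γ t) (γ t)) :=
    (contDiffAt_metricInChart g (mem_extChartAt_target (γ t))).differentiableAt (by simp)
  have h4 : christoffelFirst g (γ t) (deriv c t) (deriv c t) w =
      fderiv ℝ (metricInChart g (γ t)) (extChartAt 𝓘(ℝ, E) (γ t) (γ t)) (deriv c t) (deriv c t) w -
      (1 / 2) * fderiv ℝ (metricInChart g (γ t)) (extChartAt 𝓘(ℝ, E) (γ t) (γ t)) w (deriv c t)
        (deriv c t) := by
    have j1 := fderiv_clm_apply hG (differentiableAt_const (deriv c t))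
    have j2 := hG.hasFDerivAt.clm_apply₂ (hasFDerivAt_const (deriv c t) _)
      (hasFDerivAt_const (deriv c t) _) w
    simp only [christoffelFirst, smul_apply, sub_apply, add_apply, smul_eq_mul]
    rw [j1, j2]
    simp
    ring
  rw [← h2, ← h1, ← h, h3, h4]
  ring

/-- A magnetic geodesic solves the Euler-Lagrange equation in every preferred chart. -/
theorem IsMagneticGeodesic.eulerLagrangeAt {g : SmoothMetric E M} {α : SmoothOneForm E M}
    {γ : ℝ → M} (hγ : IsMagneticGeodesic g α γ) {x : M} {t : ℝ}
    (hx : γ t ∈ (extChartAt 𝓘(ℝ, E) x).source) :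
    EulerLagrangeAt (metricInChart g x) (oneFormInChart α x)
      (extChartAt 𝓘(ℝ, E) x (γ t)) (deriv (fun r => extChartAt 𝓘(ℝ, E) x (γ r)) t)
      (deriv (deriv (fun r => extChartAt 𝓘(ℝ, E) x (γ r))) t) := by
  set c : ℝ → E := fun r => extChartAt 𝓘(ℝ, E) x (γ r)
  set q := γ t with hqdef
  set ψ : E → E := fun y => extChartAt 𝓘(ℝ, E) q ((extChartAt 𝓘(ℝ, E) x).symm y) with hψdef
  have hct : c t ∈ (extChartAt 𝓘(ℝ, E) x).target := (extChartAt 𝓘(ℝ, E) x).map_source hx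
  have hsymm : (extChartAt 𝓘(ℝ, E) x).symm (c t) = q := (extChartAt 𝓘(ℝ, E) x).left_inv hx
  have hψc : ψ (c t) = extChartAt 𝓘(ℝ, E) q q := by simp only [hψdef, hsymm]
  have hsm : ContMDiffAt 𝓘(ℝ, E) 𝓘(ℝ, E) ∞ (extChartAt 𝓘(ℝ, E) x).symm (c t) :=
    (contMDiffOn_extChartAt_symm x).contMDiffAt ((isOpen_extChartAt_target x).mem_nhds hct)
  have hsq : (extChartAt 𝓘(ℝ, E) x).symm (c t) ∈ (extChartAt 𝓘(ℝ, E) q).source := by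
    rw [hsymm]; exact mem_extChartAt_source q
  have hψ : ContDiffAt ℝ ∞ ψ (c t) :=
    ((contMDiffAt_extChartAt' (by simpa using hsq)).comp (c t) hsm).contDiffAt
  have hψ2 : ContDiffAt ℝ 2 ψ (c t) := hψ.of_le ENat.LEInfty.out
  have hev : ∀ᶠ z in 𝓝 (c t), z ∈ (extChartAt 𝓘(ℝ, E) x).target ∧
      (extChartAt 𝓘(ℝ, E) x).symm z ∈ (extChartAt 𝓘(ℝ, E) q).source :=
    Filter.Eventually.and ((isOpen_extChartAt_target x).mem_nhds hct)
      (hsm.continuousAt ((isOpen_extChartAt_source q).mem_nhds hsq))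
  have hc : ContDiffAt ℝ ∞ c t := contDiffAt_chart_comp hγ.smooth hx
  have hcc : (fun r => extChartAt 𝓘(ℝ, E) q (γ r)) =ᶠ[𝓝 t] fun r => ψ (c r) := by
    filter_upwards [eventually_mem_chart_source hγ.smooth hx] with s hs
    simp only [hψdef, c, (extChartAt 𝓘(ℝ, E) x).left_inv hs]
  have hd : (deriv fun r => extChartAt 𝓘(ℝ, E) q (γ r)) =ᶠ[𝓝 t]
      fun r => fderiv ℝ ψ (c r) (deriv c r) := by
    have e1 : ∀ᶠ r in 𝓝 t, DifferentiableAt ℝ ψ (c r) :=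
      hc.continuousAt.eventually ((hψ2.eventually (by simp)).mono
        fun z hz => hz.differentiableAt (by simp))
    have e2 : ∀ᶠ r in 𝓝 t, DifferentiableAt ℝ c r :=
      ((hc.of_le (ENat.LEInfty.out : 2 ≤ ∞)).eventually (by simp)).mono
        fun z hz => hz.differentiableAt (by simp)
    filter_upwards [hcc.eventuallyEq_nhds, e1, e2] with r h1 h2 h3
    rw [h1.deriv_eq]
    exact (h2.hasFDerivAt.comp_hasDerivAt r h3.hasDerivAt).deriv
  have hc2 : HasDerivAt (deriv c) (deriv (deriv c) t) t := by
    have : ContDiffAt ℝ 1 (fun t => fderiv ℝ c t 1) t :=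
      ((hc.of_le ENat.LEInfty.out : ContDiffAt ℝ 2 c t).fderiv_right (m := 1) (by norm_num)).clm_apply contDiffAt_const
    exact (this.differentiableAt (by simp)).hasDerivAt
  have hc1 : HasDerivAt c (deriv c t) t := (hc.differentiableAt (by simp)).hasDerivAt
  -- Acceleration is not tensorial: the Hessian term here is the one that `EulerLagrangeAt.pullback`
  -- expects.
  have hdd : deriv (deriv fun r => extChartAt 𝓘(ℝ, E) q (γ r)) t =
      fderiv ℝ (fderiv ℝ ψ) (c t) (deriv c t) (deriv c t) +
        fderiv ℝ ψ (c t) (deriv (deriv c) t) := by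
    rw [hd.deriv_eq]
    have h1 : HasDerivAt (fun r => fderiv ℝ ψ (c r)) (fderiv ℝ (fderiv ℝ ψ) (c t) (deriv c t)) t :=
      HasFDerivAt.comp_hasDerivAt (E := E →L[ℝ] E) t
        ((hψ2.fderiv_right (m := 1) (by norm_num)).differentiableAt (by simp)).hasFDerivAt hc1
    exact (h1.clm_apply hc2).deriv
  have hqt : extChartAt 𝓘(ℝ, E) q q ∈ (extChartAt 𝓘(ℝ, E) q).target := mem_extChartAt_target q
  have hself := hγ.eulerLagrangeAt_self t
  rw [← hqdef, hdd, hd.self_of_nhds, ← hψc] at hself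
  refine EulerLagrangeAt.pullback hψ2
    ((contDiffAt_metricInChart g (by rw [hψc]; exact hqt)).differentiableAt (by simp))
    ((contDiffAt_oneFormInChart α (by rw [hψc]; exact hqt)).differentiableAt (by simp))
    ((contDiffAt_metricInChart g hct).differentiableAt (by simp))
    ((contDiffAt_oneFormInChart α hct).differentiableAt (by simp))
    (hev.mono fun z hz u w => metricInChart_transition g hz.1 hz.2 u w)
    (hev.mono fun z hz u => oneFormInChart_transition α hz.1 hz.2 u)
    (fun u w => metricInChart_symm g q _ u w) hself

end Curves

/-! ### The Killing equation of the dual field in a chart. -/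

section Killing

open Filter Topology

set_option synthInstance.maxHeartbeats 200000

variable {E : Type*} [NormedAddCommGroup E] [NormedSpace ℝ E]
  {M : Type*} [TopologicalSpace M] [ChartedSpace E M] [IsManifold 𝓘(ℝ, E) ∞ M]
  [FiniteDimensional ℝ E]

/-- A Killing field, read in the preferred chart at `x`, solves the Killing equation at `x`. -/
theorem IsKillingField.exists_chart {g : SmoothMetric E M} {X : (x : M) → TangentSpace 𝓘(ℝ, E) x}
    (hX : IsKillingField g X) (x : M) :
    ∃ Z : E → E, DifferentiableAt ℝ Z (extChartAt 𝓘(ℝ, E) x x) ∧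
      (∀ᶠ y in 𝓝 (extChartAt 𝓘(ℝ, E) x x),
        (chartInvDeriv x y (Z y) : E) = X ((extChartAt 𝓘(ℝ, E) x).symm y)) ∧
      ∀ u w, fderiv ℝ (metricInChart g x) (extChartAt 𝓘(ℝ, E) x x) (Z (extChartAt 𝓘(ℝ, E) x x)) u w +
        metricInChart g x (extChartAt 𝓘(ℝ, E) x x) (fderiv ℝ Z (extChartAt 𝓘(ℝ, E) x x) u) w +
        metricInChart g x (extChartAt 𝓘(ℝ, E) x x) u (fderiv ℝ Z (extChartAt 𝓘(ℝ, E) x x) w) = 0 := by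
  obtain ⟨φ, hφ, hφ0, hφX, hφg⟩ := hX
  set p := extChartAt 𝓘(ℝ, E) x x with hp
  let Φ : ℝ × E → E := fun q => extChartAt 𝓘(ℝ, E) x (φ q.1 ((extChartAt 𝓘(ℝ, E) x).symm q.2))
  have hpt : p ∈ (extChartAt 𝓘(ℝ, E) x).target := mem_extChartAt_target x
  have hpx : (extChartAt 𝓘(ℝ, E) x).symm p = x := extChartAt_to_inv x
  have hsm {y : E} (hy : y ∈ (extChartAt 𝓘(ℝ, E) x).target) :
      ContMDiffAt 𝓘(ℝ, E) 𝓘(ℝ, E) ∞ (extChartAt 𝓘(ℝ, E) x).symm y :=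
    (contMDiffOn_extChartAt_symm x).contMDiffAt ((isOpen_extChartAt_target x).mem_nhds hy)
  have hφs {q : ℝ × E} (hq : q.2 ∈ (extChartAt 𝓘(ℝ, E) x).target) :
      ContMDiffAt 𝓘(ℝ, ℝ × E) 𝓘(ℝ, E) ∞
        (fun q : ℝ × E => φ q.1 ((extChartAt 𝓘(ℝ, E) x).symm q.2)) q :=
    ContMDiffAt.comp q (hφ.contMDiffAt (x := (q.1, (extChartAt 𝓘(ℝ, E) x).symm q.2)))
      (ContMDiffAt.prodMk contDiffAt_fst.contMDiffAt
        ((hsm hq).comp q contDiffAt_snd.contMDiffAt))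
  have hφt (t : ℝ) : ContMDiff 𝓘(ℝ, E) 𝓘(ℝ, E) ∞ (φ t) :=
    hφ.comp (contMDiff_const.prodMk contMDiff_id)
  have hφc (y : M) : ContMDiff 𝓘(ℝ, ℝ) 𝓘(ℝ, E) ∞ (fun t => φ t y) :=
    hφ.comp (contMDiff_id.prodMk contMDiff_const)
  have hΦ : ContDiffAt ℝ 2 Φ (0, p) := by
    have h1 : φ 0 ((extChartAt 𝓘(ℝ, E) x).symm p) ∈ (chartAt E x).source := by
      rw [hφ0, hpx]; exact mem_chart_source E x
    have h2 : ContMDiffAt 𝓘(ℝ, E) 𝓘(ℝ, E) ∞ (extChartAt 𝓘(ℝ, E) x)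
      (φ ((0, p) : ℝ × E).1 ((extChartAt 𝓘(ℝ, E) x).symm ((0, p) : ℝ × E).2)) :=
      contMDiffAt_extChartAt' h1
    have h3 := (h2.comp (0, p) (hφs hpt)).contDiffAt
    exact h3.of_le ENat.LEInfty.out
  have htarget : ∀ᶠ y in 𝓝 p, y ∈ (extChartAt 𝓘(ℝ, E) x).target :=
    (isOpen_extChartAt_target x).mem_nhds hpt
  -- The witness is the initial velocity of the flow in the chart, so its smoothness comes from the
  -- flow and none has to be known for `X`.
  refine ⟨fun y => fderiv ℝ Φ (0, y) (1, 0), ?_, ?_, ?_⟩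
  · have h1 : DifferentiableAt ℝ (fderiv ℝ Φ) (0, p) :=
      (hΦ.fderiv_right (m := 1) (by norm_num)).differentiableAt (by simp)
    have h2 : DifferentiableAt ℝ (fun y : E => ((0 : ℝ), y)) p := by fun_prop
    have h3 : DifferentiableAt ℝ (fun y : E => fderiv ℝ Φ (0, y)) p := h1.comp p h2
    exact h3.clm_apply (differentiableAt_const _)
  · have hd : ∀ᶠ y in 𝓝 p, DifferentiableAt ℝ Φ (0, y) := by
      have h2 : ContinuousAt (fun y : E => ((0 : ℝ), y)) p := by fun_prop
      exact h2.eventually ((hΦ.eventually (by simp)).mono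
        fun q hq => hq.differentiableAt (by simp))
    filter_upwards [hd, htarget] with y hy hyt
    set q := (extChartAt 𝓘(ℝ, E) x).symm y
    have hq : q ∈ (extChartAt 𝓘(ℝ, E) x).source := (extChartAt 𝓘(ℝ, E) x).map_target hyt
    have hq0 : φ 0 q ∈ (extChartAt 𝓘(ℝ, E) x).source := by rwa [hφ0]
    have h1 := velocityWithin_eq_of_chart (x := x)
      ((hφc q).mdifferentiable (by simp) 0).mdifferentiableWithinAt uniqueDiffWithinAt_univ hq0
    rw [velocityWithin_univ, derivWithin_univ] at h1
    have h2 : (velocity (fun t => φ t q) 0 : E) = X (φ 0 q) := by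
      have := (hφX q 0).mfderiv
      have h3 := congrArg (fun L : ℝ →L[ℝ] E => L 1) this
      refine h3.trans ?_
      exact one_smul ℝ (X (φ 0 q) : E)
    have h4 : deriv (fun t => extChartAt 𝓘(ℝ, E) x (φ t q)) 0 = fderiv ℝ Φ (0, y) (1, 0) := by
      have i1 : HasDerivAt (fun t : ℝ => (t, y)) ((1 : ℝ), (0 : E)) 0 :=
        (hasDerivAt_id (0 : ℝ)).prodMk (hasDerivAt_const _ _)
      exact (hy.hasFDerivAt.comp_hasDerivAt_of_eq (0 : ℝ) i1 rfl).deriv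
    rw [h4] at h1
    have h5 : extChartAt 𝓘(ℝ, E) x (φ 0 q) = y := by
      rw [hφ0]; exact (extChartAt 𝓘(ℝ, E) x).right_inv hyt
    have h6 : (X (φ 0 q) : E) = X q := congrArg (fun r => (X r : E)) (hφ0 q)
    have h7 := congrArg (fun z => ((chartInvDeriv x z : E →L[ℝ] E) (fderiv ℝ Φ (0, y) (1, 0)) : E)) h5
    exact (h7.symm.trans h1.symm).trans (h2.trans h6)
  · refine killing_equation ((contDiffAt_metricInChart g hpt).differentiableAt (by simp)) hΦ ?_ ?_
    · filter_upwards [htarget] with y hy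
      simp only [Φ, hφ0]
      exact (extChartAt 𝓘(ℝ, E) x).right_inv hy
    · have hc : ContinuousAt (fun t => φ t ((extChartAt 𝓘(ℝ, E) x).symm p)) 0 :=
        (hφc _).continuous.continuousAt
      have hs : (extChartAt 𝓘(ℝ, E) x).source ∈ 𝓝 (φ 0 ((extChartAt 𝓘(ℝ, E) x).symm p)) := by
        rw [hφ0, hpx]; exact extChartAt_source_mem_nhds x
      filter_upwards [hc hs] with t ht u w
      have hmd : MDifferentiableAt 𝓘(ℝ, E) 𝓘(ℝ, E) (extChartAt 𝓘(ℝ, E) x).symm p :=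
        mdifferentiableAt_extChartAt_symm hpt
      have hft := (hφt t).mdifferentiable (by simp) ((extChartAt 𝓘(ℝ, E) x).symm p)
      have hf : MDifferentiableAt 𝓘(ℝ, E) 𝓘(ℝ, E)
          (fun y => φ t ((extChartAt 𝓘(ℝ, E) x).symm y)) p := hft.comp p hmd
      obtain ⟨h1, h2⟩ := hasMFDerivWithinAt_of_chart (s := univ) hf.mdifferentiableWithinAt ht
      have h3 := ((h2 _ (h1.differentiableAt univ_mem).hasFDerivAt.hasFDerivWithinAt).hasMFDerivAt
        univ_mem).mfderiv
      have h4 := mfderiv_comp p hft hmd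
      have h5 (v : E) : (chartInvDeriv x (Φ (t, p)) : E →L[ℝ] E) (fderiv ℝ (fun y => Φ (t, y)) p v) =
          (mfderiv 𝓘(ℝ, E) 𝓘(ℝ, E) (φ t) ((extChartAt 𝓘(ℝ, E) x).symm p) (chartInvDeriv x p v) : E) :=
        congrArg (fun L : E →L[ℝ] E => L v) (h3.symm.trans h4)
      refine (metricInChart_apply g ht _ _).trans ?_
      refine (congrArg₂ (fun a b : E => g.inner (φ t ((extChartAt 𝓘(ℝ, E) x).symm p)) a b)
        (h5 u) (h5 w)).trans ?_
      exact hφg t _ _ _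

/-- The Killing equation for the field dual to a one-form, in the preferred chart at `x`. -/
theorem exists_dualField_chart {g : SmoothMetric E M} {α : SmoothOneForm E M}
    (hK : IsKillingField g (dualField g α)) (x : M) :
    ∃ Z : E → E, DifferentiableAt ℝ Z (extChartAt 𝓘(ℝ, E) x x) ∧
      Z (extChartAt 𝓘(ℝ, E) x x) = dualField g α x ∧
      (∀ᶠ y in 𝓝 (extChartAt 𝓘(ℝ, E) x x), oneFormInChart α x y (Z y) =
        α ((extChartAt 𝓘(ℝ, E) x).symm y) (dualField g α ((extChartAt 𝓘(ℝ, E) x).symm y))) ∧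
      (∀ᶠ y in 𝓝 (extChartAt 𝓘(ℝ, E) x x), ∀ w,
        oneFormInChart α x y w = metricInChart g x y (Z y) w) ∧
      ∀ u w, fderiv ℝ (metricInChart g x) (extChartAt 𝓘(ℝ, E) x x) (Z (extChartAt 𝓘(ℝ, E) x x)) u w +
        metricInChart g x (extChartAt 𝓘(ℝ, E) x x) (fderiv ℝ Z (extChartAt 𝓘(ℝ, E) x x) u) w +
        metricInChart g x (extChartAt 𝓘(ℝ, E) x x) u (fderiv ℝ Z (extChartAt 𝓘(ℝ, E) x x) w) = 0 := by
  obtain ⟨Z, h1, h2, h3⟩ := hK.exists_chart x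
  refine ⟨Z, h1, ?_, ?_, ?_, h3⟩
  · have i1 := h2.self_of_nhds
    have i2 := congrArg (fun L : E →L[ℝ] E => L (Z (extChartAt 𝓘(ℝ, E) x x)))
      (chartInvDeriv_self (E := E) x)
    have i3 : (dualField g α ((extChartAt 𝓘(ℝ, E) x).symm (extChartAt 𝓘(ℝ, E) x x)) : E) =
      dualField g α x := congrArg (fun q => (dualField g α q : E)) (extChartAt_to_inv x)
    exact i2.symm.trans (i1.trans i3)
  · filter_upwards [h2] with y hy
    exact congrArg (fun v : E => α ((extChartAt 𝓘(ℝ, E) x).symm y) v) hy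
  · filter_upwards [h2] with y hy w
    have i1 := inner_sharp g ((extChartAt 𝓘(ℝ, E) x).symm y) (α ((extChartAt 𝓘(ℝ, E) x).symm y))
      (chartInvDeriv x y w)
    refine i1.symm.trans ?_
    exact congrArg (fun v : E => g.inner ((extChartAt 𝓘(ℝ, E) x).symm y) v
      (chartInvDeriv x y w)) hy.symm

end Killing

/-! ### Pointwise identities behind the conserved quantities. -/

section Conservation

open Filter Topology

set_option synthInstance.maxHeartbeats 200000

variable {E : Type*} [NormedAddCommGroup E] [NormedSpace ℝ E]

theorem fderiv_form_apply {G : E → E →L[ℝ] E →L[ℝ] ℝ} {A : E → E →L[ℝ] ℝ} {Z : E → E} {p : E}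
    (hG : DifferentiableAt ℝ G p) (hA : DifferentiableAt ℝ A p) (hZ : DifferentiableAt ℝ Z p)
    (hAG : ∀ᶠ y in 𝓝 p, ∀ w, A y w = G y (Z y) w) (u w : E) :
    fderiv ℝ A p u w = fderiv ℝ G p u (Z p) w + G p (fderiv ℝ Z p u) w := by
  have h1 := (hA.hasFDerivAt.clm_apply (hasFDerivAt_const w p)).fderiv
  have h2 := hG.hasFDerivAt.clm_apply₂ hZ.hasFDerivAt (hasFDerivAt_const w p) u
  have h3 : (fun y => A y w) =ᶠ[𝓝 p] fun y => G y (Z y) w := hAG.mono fun y hy => hy w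
  rw [← h3.fderiv_eq, h1] at h2
  simpa using h2

theorem fderiv_apply_symm {G : E → E →L[ℝ] E →L[ℝ] ℝ} {p : E} (hG : DifferentiableAt ℝ G p)
    (hsymm : ∀ y u w, G y u w = G y w u) (z u w : E) :
    fderiv ℝ G p z u w = fderiv ℝ G p z w u := by
  have h1 := hG.hasFDerivAt.clm_apply₂ (hasFDerivAt_const u p) (hasFDerivAt_const w p) z
  have h2 := hG.hasFDerivAt.clm_apply₂ (hasFDerivAt_const w p) (hasFDerivAt_const u p) z
  have h3 : (fun y => G y u w) = fun y => G y w u := funext fun y => hsymm y u w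
  rw [h3, h2] at h1
  simpa using h1.symm

/-- The norm of a Killing field `Z` is stationary if the dual form `A` satisfies `dA(Z, ·) = 0`. -/
theorem fderiv_norm_killing {G : E → E →L[ℝ] E →L[ℝ] ℝ} {A : E → E →L[ℝ] ℝ} {Z : E → E} {p : E}
    (hG : DifferentiableAt ℝ G p) (hA : DifferentiableAt ℝ A p) (hZ : DifferentiableAt ℝ Z p)
    (hAG : ∀ᶠ y in 𝓝 p, ∀ w, A y w = G y (Z y) w)
    (hK : ∀ u w, fderiv ℝ G p (Z p) u w + G p (fderiv ℝ Z p u) w + G p u (fderiv ℝ Z p w) = 0)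
    (hdA : ∀ w, fderiv ℝ A p (Z p) w - fderiv ℝ A p w (Z p) = 0) :
    HasFDerivAt (fun y => A y (Z y)) (0 : E →L[ℝ] ℝ) p := by
  have h := hA.hasFDerivAt.clm_apply hZ.hasFDerivAt
  refine h.congr_fderiv ?_
  ext w
  -- `hdA` replaces the derivative of `A` along `w` by that along `Z p`; the Killing equation on `(Z
  -- p, w)` then cancels everything.
  have h1 := fderiv_form_apply hG hA hZ hAG (Z p) w
  have h2 := hK (Z p) w
  have h3 := hdA w
  have h4 := hAG.self_of_nhds (fderiv ℝ Z p w)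
  simp
  linarith

/-- The equation `d/dt A(c') = 0` along solutions of the Euler-Lagrange equation. -/
theorem EulerLagrangeAt.killing_momentum {G : E → E →L[ℝ] E →L[ℝ] ℝ} {A : E → E →L[ℝ] ℝ}
    {Z : E → E} {p v a : E} (hsymm : ∀ y u w, G y u w = G y w u)
    (hG : DifferentiableAt ℝ G p) (hA : DifferentiableAt ℝ A p) (hZ : DifferentiableAt ℝ Z p)
    (hAG : ∀ᶠ y in 𝓝 p, ∀ w, A y w = G y (Z y) w)
    (hK : ∀ u w, fderiv ℝ G p (Z p) u w + G p (fderiv ℝ Z p u) w + G p u (fderiv ℝ Z p w) = 0)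
    (hdA : ∀ w, fderiv ℝ A p (Z p) w - fderiv ℝ A p w (Z p) = 0)
    (h : EulerLagrangeAt G A p v a) : fderiv ℝ A p v v + A p a = 0 := by
  have h1 := fderiv_form_apply hG hA hZ hAG v v
  have h2 := hK v v
  have h3 := hdA v
  have h4 := hAG.self_of_nhds a
  -- Testing against the Killing field itself makes the magnetic term vanish by `hdA`.
  have h5 := h (Z p)
  have h6 := fderiv_apply_symm hG hsymm v v (Z p)
  have h7 := hsymm p (Z p) a
  have h8 := hsymm p v (fderiv ℝ Z p v)
  linarith

end Conservation

/-! ### Conserved quantities along magnetic geodesics and the two cases of the theorem. -/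

section MagneticGeodesics

open Filter Topology MeasureTheory

set_option synthInstance.maxHeartbeats 200000

variable {E : Type*} [NormedAddCommGroup E] [NormedSpace ℝ E]
  {M : Type*} [TopologicalSpace M] [ChartedSpace E M] [IsManifold 𝓘(ℝ, E) ∞ M]

theorem hasDerivAt_deriv_chart_comp {γ : ℝ → M} (hγ : ContMDiff 𝓘(ℝ, ℝ) 𝓘(ℝ, E) ∞ γ) (t : ℝ) :
    HasDerivAt (fun r => extChartAt 𝓘(ℝ, E) (γ t) (γ r))
      (deriv (fun r => extChartAt 𝓘(ℝ, E) (γ t) (γ r)) t) t ∧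
    HasDerivAt (deriv fun r => extChartAt 𝓘(ℝ, E) (γ t) (γ r))
      (deriv (deriv fun r => extChartAt 𝓘(ℝ, E) (γ t) (γ r)) t) t := by
  have hc := (contDiffAt_chart_comp hγ (mem_extChartAt_source (γ t))).of_le
    (ENat.LEInfty.out : 2 ≤ ∞)
  refine ⟨(hc.differentiableAt (by simp)).hasDerivAt, ?_⟩
  have : ContDiffAt ℝ 1 (fun s => fderiv ℝ (fun r => extChartAt 𝓘(ℝ, E) (γ t) (γ r)) s 1) t :=
    (hc.fderiv_right (m := 1) (by norm_num)).clm_apply contDiffAt_const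
  exact (this.differentiableAt (by simp)).hasDerivAt

theorem eq_of_hasDerivAt_zero {f : ℝ → ℝ} (hf : ∀ t, HasDerivAt f 0 t) (s t : ℝ) :
    f s = f t :=
  is_const_of_deriv_eq_zero (fun t => (hf t).differentiableAt) (fun t => (hf t).deriv) s t

theorem chart_curve_regular {δ : ℝ → M} {a b : ℝ} (hab : a < b)
    (hδ : ContMDiffOn 𝓘(ℝ, ℝ) 𝓘(ℝ, E) 1 δ (Icc a b)) {t : ℝ} (ht : t ∈ Icc a b) {x : M}
    (hx : δ t ∈ (extChartAt 𝓘(ℝ, E) x).source) :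
    HasDerivWithinAt (fun r => extChartAt 𝓘(ℝ, E) x (δ r))
      (derivWithin (fun r => extChartAt 𝓘(ℝ, E) x (δ r)) (Icc a b) t) (Icc a b) t ∧
    ContinuousWithinAt (derivWithin (fun r => extChartAt 𝓘(ℝ, E) x (δ r)) (Icc a b)) (Icc a b) t := by
  have h : ContDiffWithinAt ℝ 1 (fun r => extChartAt 𝓘(ℝ, E) x (δ r)) (Icc a b) t :=
    ((contMDiffAt_extChartAt' (by simpa using hx)).comp_contMDiffWithinAt t (hδ t ht)).contDiffWithinAt
  refine ⟨(h.differentiableWithinAt (by simp)).hasDerivWithinAt, ?_⟩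
  have h1 := (h.fderivWithin_right (m := 0) (uniqueDiffOn_Icc hab) (by simp) ht).continuousWithinAt
  exact h1.clm_apply (continuousWithinAt_const (b := (1 : ℝ)))

theorem energy_density_nonneg (g : SmoothMetric E M) (q : M) (v : TangentSpace 𝓘(ℝ, E) q) :
    0 ≤ (1 / 2 : ℝ) * g.inner q v v := by
  rcases eq_or_ne v 0 with rfl | h
  · simp
  · have := g.pos q v h
    positivity

variable [FiniteDimensional ℝ E]

/-- The Lorentz force does no work: with the velocity as test vector the right side of the
Euler-Lagrange equation is zero, and the left side is half the derivative of the squared speed. -/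
theorem IsMagneticGeodesic.energy_const {g : SmoothMetric E M} {α : SmoothOneForm E M}
    {γ : ℝ → M} (hγ : IsMagneticGeodesic g α γ) (s t : ℝ) :
    g.inner (γ s) (velocity γ s) (velocity γ s) = g.inner (γ t) (velocity γ t) (velocity γ t) := by
  refine eq_of_hasDerivAt_zero (f := fun t => g.inner (γ t) (velocity γ t) (velocity γ t))
    (fun t => ?_) s t
  have hx := mem_extChartAt_source (I := 𝓘(ℝ, E)) (γ t)
  obtain ⟨h1, h2⟩ := hasDerivAt_deriv_chart_comp hγ.smooth t
  have hG : DifferentiableAt ℝ (metricInChart g (γ t)) (extChartAt 𝓘(ℝ, E) (γ t) (γ t)) :=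
    (contDiffAt_metricInChart g (mem_extChartAt_target (γ t))).differentiableAt (by simp)
  have h3 := HasFDerivAt.comp_hasDerivAt (E := E →L[ℝ] E →L[ℝ] ℝ) t hG.hasFDerivAt h1
  have h4 := h3.clm_apply₂ h2 h2
  have hev : (fun s => g.inner (γ s) (velocity γ s) (velocity γ s)) =ᶠ[𝓝 t] _ :=
    (eventually_mem_chart_source hγ.smooth hx).mono fun s hs =>
      metric_velocity g (hγ.smooth.mdifferentiable (by simp) s) hs
  refine (h4.congr_of_eventuallyEq hev).congr_deriv ?_
  have h5 := hγ.eulerLagrangeAt_self t (deriv (fun r => extChartAt 𝓘(ℝ, E) (γ t) (γ r)) t)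
  have h6 := metricInChart_symm g (γ t) (extChartAt 𝓘(ℝ, E) (γ t) (γ t))
    (deriv (fun r => extChartAt 𝓘(ℝ, E) (γ t) (γ r)) t)
    (deriv (deriv fun r => extChartAt 𝓘(ℝ, E) (γ t) (γ r)) t)
  simp only [Function.comp]
  linarith

theorem fderiv_dualField_eq_zero {g : SmoothMetric E M} {α : SmoothOneForm E M}
    (hX : ∀ x v, dOneForm α x (dualField g α x) v = 0) {x : M} {Z : E}
    (hZ : Z = dualField g α x) (w : E) :
    fderiv ℝ (oneFormInChart α x) (extChartAt 𝓘(ℝ, E) x x) Z w -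
      fderiv ℝ (oneFormInChart α x) (extChartAt 𝓘(ℝ, E) x x) w Z = 0 := by
  subst hZ
  exact hX x w

theorem IsMagneticGeodesic.oneForm_velocity_const {g : SmoothMetric E M} {α : SmoothOneForm E M}
    {γ : ℝ → M} (hγ : IsMagneticGeodesic g α γ) (hK : IsKillingField g (dualField g α))
    (hX : ∀ x v, dOneForm α x (dualField g α x) v = 0) (s t : ℝ) :
    α (γ s) (velocity γ s) = α (γ t) (velocity γ t) := by
  refine eq_of_hasDerivAt_zero (f := fun t => α (γ t) (velocity γ t)) (fun t => ?_) s t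
  have hx := mem_extChartAt_source (I := 𝓘(ℝ, E)) (γ t)
  obtain ⟨h1, h2⟩ := hasDerivAt_deriv_chart_comp hγ.smooth t
  have hG : DifferentiableAt ℝ (metricInChart g (γ t)) (extChartAt 𝓘(ℝ, E) (γ t) (γ t)) :=
    (contDiffAt_metricInChart g (mem_extChartAt_target (γ t))).differentiableAt (by simp)
  have hA : DifferentiableAt ℝ (oneFormInChart α (γ t)) (extChartAt 𝓘(ℝ, E) (γ t) (γ t)) :=
    (contDiffAt_oneFormInChart α (mem_extChartAt_target (γ t))).differentiableAt (by simp)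
  have h3 := HasFDerivAt.comp_hasDerivAt (E := E →L[ℝ] ℝ) t hA.hasFDerivAt h1
  have h4 := h3.clm_apply h2
  have hev : (fun s => α (γ s) (velocity γ s)) =ᶠ[𝓝 t] _ :=
    (eventually_mem_chart_source hγ.smooth hx).mono fun s hs =>
      oneForm_velocity α (hγ.smooth.mdifferentiable (by simp) s) hs
  refine (h4.congr_of_eventuallyEq hev).congr_deriv ?_
  obtain ⟨Z, hZ, hZX, -, hAG, hKE⟩ := exists_dualField_chart hK (γ t)
  exact (hγ.eulerLagrangeAt_self t).killing_momentum (metricInChart_symm g (γ t)) hG hA hZ hAG hKE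
    (fderiv_dualField_eq_zero hX hZX)

/-- The squared length of X has zero differential at every point. Constancy is claimed along a
curve, which avoids any connectedness assumption on `M`. -/
theorem oneForm_dualField_const {g : SmoothMetric E M} {α : SmoothOneForm E M}
    {γ : ℝ → M} (hγ : ContMDiff 𝓘(ℝ, ℝ) 𝓘(ℝ, E) ∞ γ) (hK : IsKillingField g (dualField g α))
    (hX : ∀ x v, dOneForm α x (dualField g α x) v = 0) (s t : ℝ) :
    α (γ s) (dualField g α (γ s)) = α (γ t) (dualField g α (γ t)) := by
  refine eq_of_hasDerivAt_zero (f := fun t => α (γ t) (dualField g α (γ t)))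
    (fun t => ?_) s t
  have hx := mem_extChartAt_source (I := 𝓘(ℝ, E)) (γ t)
  obtain ⟨h1, h2⟩ := hasDerivAt_deriv_chart_comp hγ t
  have hG : DifferentiableAt ℝ (metricInChart g (γ t)) (extChartAt 𝓘(ℝ, E) (γ t) (γ t)) :=
    (contDiffAt_metricInChart g (mem_extChartAt_target (γ t))).differentiableAt (by simp)
  have hA : DifferentiableAt ℝ (oneFormInChart α (γ t)) (extChartAt 𝓘(ℝ, E) (γ t) (γ t)) :=
    (contDiffAt_oneFormInChart α (mem_extChartAt_target (γ t))).differentiableAt (by simp)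
  obtain ⟨Z, hZ, hZX, hAZ, hAG, hKE⟩ := exists_dualField_chart hK (γ t)
  have h3 := fderiv_norm_killing hG hA hZ hAG hKE (fderiv_dualField_eq_zero hX hZX)
  have h4 := h3.comp_hasDerivAt t h1
  refine (h4.congr_of_eventuallyEq ?_).congr_deriv (by simp)
  filter_upwards [eventually_mem_chart_source hγ hx, h1.continuousAt.eventually hAZ] with s hs h
  have h5 := congrArg (fun q => α q (dualField g α q))
    ((extChartAt 𝓘(ℝ, E) (γ t)).left_inv hs)
  exact h5.symm.trans h.symm

/-- Equality in the Cauchy-Schwarz inequality. -/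
theorem IsMagneticGeodesic.velocity_eq_smul_dualField {g : SmoothMetric E M}
    {α : SmoothOneForm E M} {γ : ℝ → M} (hγ : IsMagneticGeodesic g α γ)
    (hK : IsKillingField g (dualField g α))
    (hX : ∀ x v, dOneForm α x (dualField g α x) v = 0) {r : ℝ}
    (h0 : velocity γ 0 = r • dualField g α (γ 0)) (t : ℝ) :
    velocity γ t = r • dualField g α (γ t) := by
  have hdual (q : M) (w : TangentSpace 𝓘(ℝ, E) q) : g.inner q (dualField g α q) w = α q w :=
    inner_sharp _ _ _ _
  have h1 := hγ.energy_const t 0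
  have h2 := hγ.oneForm_velocity_const hK hX t 0
  have h3 := oneForm_dualField_const hγ.smooth hK hX t 0
  rw [h0] at h1 h2
  simp only [map_smul, smul_apply, smul_eq_mul, hdual] at h1 h2
  by_contra hne
  -- Expanding this square with the three conserved values gives `r ^ 2 - 2 * r ^ 2 + r ^ 2` times
  -- the squared length of X, which is zero.
  have hpos := g.pos (γ t) (velocity γ t - r • dualField g α (γ t)) (sub_ne_zero.2 hne)
  have h4 := g.symm (γ t) (velocity γ t) (dualField g α (γ t))
  simp only [map_sub, sub_apply, map_smul, smul_apply, smul_eq_mul, h4, hdual] at hpos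
  rw [h1, h2, h3] at hpos
  linarith

theorem continuousOn_energy_density (g : SmoothMetric E M) {δ : ℝ → M} {a b : ℝ} (hab : a < b)
    (hδ : ContMDiffOn 𝓘(ℝ, ℝ) 𝓘(ℝ, E) 1 δ (Icc a b)) :
    ContinuousOn (fun t => (1 / 2 : ℝ) *
      g.inner (δ t) (velocityWithin δ (Icc a b) t) (velocityWithin δ (Icc a b) t)) (Icc a b) := by
  intro t ht
  have hx := mem_extChartAt_source (I := 𝓘(ℝ, E)) (δ t)
  obtain ⟨h1, h2⟩ := chart_curve_regular hab hδ ht hx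
  have h3 := (continuousWithinAt_metric_apply
    (contDiffAt_metricInChart g ((extChartAt 𝓘(ℝ, E) (δ t)).map_source hx))
    h1.continuousWithinAt h2).const_mul (1 / 2)
  refine h3.congr_of_eventuallyEq_of_mem ?_ ht
  have hs := (hδ t ht).continuousWithinAt.preimage_mem_nhdsWithin
    ((isOpen_extChartAt_source (I := 𝓘(ℝ, E)) (δ t)).mem_nhds hx)
  filter_upwards [hs, self_mem_nhdsWithin] with s hs hsab
  rw [metric_velocityWithin g ((hδ.mdifferentiableOn (by simp)) s hsab)
    (uniqueDiffOn_Icc hab s hsab) hs]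

/-- The action minimization in a chart at `γ t₀`, applied to horizontal curves, for which the term
`A(v)` vanishes. A competitor may leave the chart, so it is followed only up to its first exit from
the ball `O`. -/
theorem IsMagneticGeodesic.isSubRiemannianGeodesic [T2Space M] {g : SmoothMetric E M}
    {α : SmoothOneForm E M} {γ : ℝ → M} (hγ : IsMagneticGeodesic g α γ)
    (hhor : ∀ t, α (γ t) (velocity γ t) = 0) : IsSubRiemannianGeodesic g α γ := by
  refine ⟨hγ.smooth, hhor, fun t₀ => ?_⟩
  set x := γ t₀
  let c : ℝ → E := fun r => extChartAt 𝓘(ℝ, E) x (γ r)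
  have hx : γ t₀ ∈ (extChartAt 𝓘(ℝ, E) x).source := mem_extChartAt_source x
  have hct : c t₀ ∈ (extChartAt 𝓘(ℝ, E) x).target := (extChartAt 𝓘(ℝ, E) x).map_source hx
  obtain ⟨ε₁, hε₁, hsrc⟩ := Metric.eventually_nhds_iff_ball.1
    (eventually_mem_chart_source hγ.smooth hx)
  obtain ⟨R, hR, hRU, ε₂, hε₂, hmin⟩ := exists_short_arcs_minimizing (c := c) (t₀ := t₀)
    ((isOpen_extChartAt_target x).mem_nhds hct) (contDiffAt_metricInChart g hct)
    (contDiffAt_oneFormInChart α hct) (metricInChart_symm g x)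
    (fun v hv => by
      have h1 : metricInChart g x (c t₀) v v = _ := metricInChart_self g x v v
      rw [h1]
      exact g.pos x v hv)
    ((contDiffAt_chart_comp hγ.smooth hx).of_le ENat.LEInfty.out)
    ((eventually_mem_chart_source hγ.smooth hx).mono fun t ht => hγ.eulerLagrangeAt ht)
  refine ⟨min ε₁ ε₂, lt_min hε₁ hε₂, fun a b ha hab hb δ hδ hδh hδa hδb => ?_⟩
  have hm1 := min_le_left ε₁ ε₂
  have hm2 := min_le_right ε₁ ε₂
  obtain ⟨hcR, hin, hout⟩ := hmin a b (by linarith) hab (by linarith)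
  have hγs (t : ℝ) (ht : t ∈ Icc a b) : γ t ∈ (extChartAt 𝓘(ℝ, E) x).source := hsrc t (by
    rw [Metric.mem_ball, Real.dist_eq, abs_lt]
    constructor <;> linarith [ht.1, ht.2])
  have hud := uniqueDiffOn_Icc hab
  have hδd := hδ.mdifferentiableOn (by simp)
  have hγE : curveEnergy g γ a b =
      ∫ t in a..b, (1 / 2) * metricInChart g x (c t) (deriv c t) (deriv c t) := by
    refine intervalIntegral.integral_congr fun t ht => ?_
    rw [uIcc_of_le hab.le] at ht
    have hγd := hγ.smooth.mdifferentiable (by simp) t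
    rw [velocityWithin_eq_velocity hγd (hud t ht), metric_velocity g hγd (hγs t ht)]
  let e : ℝ → E := fun r => extChartAt 𝓘(ℝ, E) x (δ r)
  let e' : ℝ → E := derivWithin e (Icc a b)
  have hO : IsOpen ((extChartAt 𝓘(ℝ, E) x).source ∩
      extChartAt 𝓘(ℝ, E) x ⁻¹' Metric.ball (c t₀) R) :=
    (continuousOn_extChartAt x).isOpen_inter_preimage (isOpen_extChartAt_source x)
      Metric.isOpen_ball
  set O := (extChartAt 𝓘(ℝ, E) x).source ∩ extChartAt 𝓘(ℝ, E) x ⁻¹' Metric.ball (c t₀) R with hOdef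
  by_cases hZ : ({t | t ∈ Icc a b ∧ δ t ∈ Oᶜ} : Set ℝ).Nonempty
  · have hZc : IsCompact ({t | t ∈ Icc a b ∧ δ t ∈ Oᶜ} : Set ℝ) :=
      isCompact_Icc.of_isClosed_subset
        (hδ.continuousOn.preimage_isClosed_of_isClosed isClosed_Icc hO.isClosed_compl)
        fun t ht => ht.1
    obtain ⟨τ, ⟨hτ, hτO⟩, hτmin⟩ := hZc.exists_isLeast hZ
    have haτ : a < τ := by
      refine lt_of_le_of_ne hτ.1 fun h => hτO ?_
      have haI : a ∈ Icc a b := left_mem_Icc.2 hab.le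
      rw [← h, hδa]
      exact ⟨hγs a haI, hcR a haI⟩
    have hlt (t : ℝ) (ht : t ∈ Ico a τ) : δ t ∈ O := by
      by_contra h
      exact absurd (hτmin ⟨⟨ht.1, ht.2.le.trans hτ.2⟩, h⟩) (not_le.2 ht.2)
    -- The compact image of the closed ball is closed because `M` is Hausdorff; hence at the exit
    -- time `τ` the curve is still in the chart domain, and its coordinates lie on the boundary
    -- sphere.
    have hK : IsClosed ((extChartAt 𝓘(ℝ, E) x).symm '' Metric.closedBall (c t₀) R) :=
      ((isCompact_closedBall (c t₀) R).image_of_continuousOn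
        ((continuousOn_extChartAt_symm x).mono hRU)).isClosed
    have hOK : O ⊆ (extChartAt 𝓘(ℝ, E) x).symm '' Metric.closedBall (c t₀) R := fun q hq =>
      ⟨_, Metric.ball_subset_closedBall hq.2, (extChartAt 𝓘(ℝ, E) x).left_inv hq.1⟩
    have hτK : δ τ ∈ (extChartAt 𝓘(ℝ, E) x).symm '' Metric.closedBall (c t₀) R := by
      have h1 : ContinuousWithinAt δ (Ico a τ) τ := (hδ.continuousOn τ hτ).mono
        fun t ht => ⟨ht.1, ht.2.le.trans hτ.2⟩
      have h2 : τ ∈ closure (Ico a τ) := by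
        rw [closure_Ico haτ.ne]; exact right_mem_Icc.2 haτ.le
      exact closure_minimal hOK hK (h1.mem_closure h2 hlt)
    have hmem (t : ℝ) (ht : t ∈ Icc a τ) :
        δ t ∈ (extChartAt 𝓘(ℝ, E) x).source ∧ e t ∈ Metric.closedBall (c t₀) R := by
      have h1 : δ t ∈ (extChartAt 𝓘(ℝ, E) x).symm '' Metric.closedBall (c t₀) R := by
        rcases eq_or_lt_of_le ht.2 with rfl | h
        · exact hτK
        · exact hOK (hlt t ⟨ht.1, h⟩)
      obtain ⟨z, hz, hzt⟩ := h1
      have h2 : e t = z := by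
        simp only [e, ← hzt, (extChartAt 𝓘(ℝ, E) x).right_inv (hRU hz)]
      exact ⟨hzt ▸ (extChartAt 𝓘(ℝ, E) x).map_target (hRU hz), h2 ▸ hz⟩
    have hsub : Icc a τ ⊆ Icc a b := Icc_subset_Icc_right hτ.2
    have h1 := hout e e' τ haτ hτ.2 (fun t ht => (hmem t ht).2)
      (fun t ht => (chart_curve_regular hab hδ (hsub ht) (hmem t ht).1).2.mono hsub)
      (fun t ht => (chart_curve_regular hab hδ (hsub ht) (hmem t ht).1).1.mono hsub)
      (congrArg (extChartAt 𝓘(ℝ, E) x) hδa)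
      (fun h => hτO ⟨(hmem τ (right_mem_Icc.2 haτ.le)).1, h⟩)
    rw [hγE]
    refine h1.trans ?_
    have h2 : ∫ t in a..τ, (1 / 2) * metricInChart g x (e t) (e' t) (e' t) =
        ∫ t in a..τ, (1 / 2 : ℝ) *
          g.inner (δ t) (velocityWithin δ (Icc a b) t) (velocityWithin δ (Icc a b) t) := by
      refine intervalIntegral.integral_congr fun t ht => ?_
      rw [uIcc_of_le haτ.le] at ht
      rw [metric_velocityWithin g (hδd t (hsub ht)) (hud t (hsub ht)) (hmem t ht).1]
    rw [h2]
    -- The energy spent after `τ` is nonnegative and can be discarded.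
    refine intervalIntegral.integral_mono_interval le_rfl haτ.le hτ.2
      (Eventually.of_forall fun t => energy_density_nonneg g _ _) ?_
    exact ContinuousOn.intervalIntegrable
      (by rw [uIcc_of_le hab.le]; exact continuousOn_energy_density g hab hδ)
  · have hmem (t : ℝ) (ht : t ∈ Icc a b) : δ t ∈ O := by
      by_contra h
      exact hZ ⟨t, ht, h⟩
    have h1 := hin e e' (fun t ht => Metric.ball_subset_closedBall (hmem t ht).2)
      (fun t ht => (chart_curve_regular hab hδ ht (hmem t ht).1).2)
      (fun t ht => (chart_curve_regular hab hδ ht (hmem t ht).1).1)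
      (congrArg (extChartAt 𝓘(ℝ, E) x) hδa) (congrArg (extChartAt 𝓘(ℝ, E) x) hδb)
    have hγL : ∫ t in a..b, magneticLagrangian (metricInChart g x) (oneFormInChart α x) (c t)
        (deriv c t) = curveEnergy g γ a b := by
      rw [hγE]
      refine intervalIntegral.integral_congr fun t ht => ?_
      rw [uIcc_of_le hab.le] at ht
      have h2 := oneForm_velocity α (hγ.smooth.mdifferentiable (by simp) t) (hγs t ht)
      rw [hhor] at h2
      simp only [magneticLagrangian]
      change _ - oneFormInChart α x (extChartAt 𝓘(ℝ, E) x (γ t))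
        (deriv (fun r => extChartAt 𝓘(ℝ, E) x (γ r)) t) = _
      rw [← h2, sub_zero]
    have hδL : ∫ t in a..b, magneticLagrangian (metricInChart g x) (oneFormInChart α x) (e t)
        (e' t) = curveEnergy g δ a b := by
      refine intervalIntegral.integral_congr fun t ht => ?_
      rw [uIcc_of_le hab.le] at ht
      have h2 := oneForm_velocityWithin α (hδd t ht) (hud t ht) (hmem t ht).1
      have h3 := metric_velocityWithin g (hδd t ht) (hud t ht) (hmem t ht).1
      rw [hδh t ht] at h2
      simp only [magneticLagrangian]
      change _ - oneFormInChart α x (extChartAt 𝓘(ℝ, E) x (δ t))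
        (derivWithin (fun r => extChartAt 𝓘(ℝ, E) x (δ r)) (Icc a b) t) = _
      rw [← h2, sub_zero, h3]
    rwa [hγL, hδL] at h1

end MagneticGeodesics

/-! ### Assembly of the main theorem. -/

theorem mainTheorem1 (n : ℕ)
    {M : Type*} [TopologicalSpace M] [T2Space M] [CompactSpace M]
    [ChartedSpace (EuclideanSpace ℝ (Fin (2 * n + 1))) M]
    [IsManifold 𝓘(ℝ, EuclideanSpace ℝ (Fin (2 * n + 1))) ∞ M]
    (g : SmoothMetric (EuclideanSpace ℝ (Fin (2 * n + 1))) M)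
    (α : SmoothOneForm (EuclideanSpace ℝ (Fin (2 * n + 1))) M)
    (hcontact : IsContactForm n α)
    (hKilling : IsKillingField g (dualField g α))
    (hX : ∀ x v, dOneForm α x (dualField g α x) v = 0)
    (γ : ℝ → M) (hγ : IsMagneticGeodesic g α γ) :
    (∀ s t, g.inner (γ s) (dualField g α (γ s)) (velocity γ s) =
      g.inner (γ t) (dualField g α (γ t)) (velocity γ t)) ∧
    (α (γ 0) (velocity γ 0) = 0 → IsSubRiemannianGeodesic g α γ) ∧
    (∀ r : ℝ, velocity γ 0 = r • dualField g α (γ 0) →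
      IsMIntegralCurve γ (fun x => r • dualField g α x)) := by
  refine ⟨fun s t => ?_, fun h => ?_, fun r hr t => ?_⟩
  · exact (inner_sharp g (γ s) (α (γ s)) _).trans
      ((hγ.oneForm_velocity_const hKilling hX s t).trans
        (inner_sharp g (γ t) (α (γ t)) _).symm)
  · exact hγ.isSubRiemannianGeodesic fun t =>
      (hγ.oneForm_velocity_const hKilling hX t 0).trans h
  · have h1 := (hγ.smooth.mdifferentiable (by simp) t).hasMFDerivAt
    have h2 := hγ.velocity_eq_smul_dualField hKilling hX hr t
    refine h1.congr_mfderiv ?_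
    refine ContinuousLinearMap.ext_ring (h2.trans ?_)
    exact (one_smul ℝ (r • dualField g α (γ t) : EuclideanSpace ℝ (Fin (2 * n + 1)))).symm
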